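/- For $d \ge 2$ let $\Gamma_d = \{(t,t^2,\dots,t^d) : t\in[0,1]\}\subset\mathbb{R}^d$ be the moment curve, and for $0<\alpha\le 1$ put $$p_\alpha = \begin{cases} \dfrac{d^2+d+2\alpha}{2\alpha} & \text{if } d\ge 3,\\[2mm] \dfrac{4}{\alpha} & \text{if } d=2.\end{cases}$$ For a bounded set $E\subset\mathbb{R}^d$ and $0<\varepsilon<1$ let $N(E,\varepsilon)$ be the smallest number of balls of radius $\varepsilon$, with centres in $\mathbb{R}^d$, needed to cover $E$. Let $d\ge 2$, $0<\alpha\le 1$ and $p_\alpha<p\le\infty$. Then there exist a nonzero $f\in L^p(\mathbb{R}^d)$ and a constant $C$ such that the support of the Fourier transform $\widehat f$, taken in the sense of tempered distributions, satisfies $\operatorname{spt}\widehat f\subseteq\Gamma_d$ and $$N(\operatorname{spt}\widehat f,\varepsilon)\le C\,\varepsilon^{-\alpha}\qquad\text{for all } 0<\varepsilon<1.$$ -/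

import Mathlib

open MeasureTheory FourierTransform TemperedDistribution
open scoped NNReal ENNReal SchwartzMap

/-- The moment curve `Γ_d = {(t, t², …, t^d) : t ∈ [0,1]}` in `ℝ^d`. -/
def momentCurve (d : ℕ) : Set (EuclideanSpace ℝ (Fin d)) :=
  (fun t : ℝ => WithLp.toLp 2 (fun i : Fin d => t ^ ((i : ℕ) + 1))) '' Set.Icc (0 : ℝ) 1

/-- The critical exponent `p_α` in dimension `d ≥ 2`. -/
noncomputable def criticalExponent (d : ℕ) (α : ℝ) : ℝ :=
  if d = 2 then 4 / α else ((d : ℝ) ^ 2 + d + 2 * α) / (2 * α)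

/-- The support of the Fourier transform (in the sense of tempered distributions, normalized with
`e^{-2πi⟨x,ξ⟩}`) of a function `f ∈ L^p(ℝ^d)`. -/
noncomputable def fourierSupport {d : ℕ} {p : ℝ≥0∞} [Fact (1 ≤ p)]
    (f : Lp ℂ p (volume : Measure (EuclideanSpace ℝ (Fin d)))) :
    Set (EuclideanSpace ℝ (Fin d)) :=
  Distribution.dsupport
    (𝓕 (Lp.toTemperedDistribution f : 𝓢'(EuclideanSpace ℝ (Fin d), ℂ)) :
      𝓢'(EuclideanSpace ℝ (Fin d), ℂ))

/-!
The function `f` is the Fourier transform of a Cantor measure on the moment curve. Let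
`e k = ⌊α k⌋`. The `k`-th generation consists of `2 ^ e k` dyadic intervals of length `2⁻ᵏ`; when
`e (k + 1) = e k + 1` both halves of every interval are kept, and otherwise one half of each is
chosen. Whatever the choices, the covering numbers are right, so the choices are free to make the
Fourier transforms `f_k` of the uniform measures on the generations converge in `L^p`. The
difference `f_{k+1} - f_k` is a sum of terms with freely chosen signs, so by Khintchine's inequality
(`exists_signs`) some choice has `L^p` norm bounded by that of the square function of the arcs.

The square function is bounded for every regular family of arcs. For fixed `ξ` let `g` be the
derivative of the phase `t ↦ ⟨ξ, (t, …, t^d)⟩`, a polynomial. On an interval where `g` is monotone,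
`{|g| ≤ 2ⁿ}` is an interval, and by van der Corput's estimate an arc is `O(2⁻ⁿ)` in size for the
first `n ≥ k` for which it meets such an interval of length at least `4 · 2⁻ⁿ`. Summation over the
arcs gives `arcSquareSum_le`: the square function is at most a sum over scales `n ≥ k` and `r ≤ n` of
`4⁻ⁿ` times the number of arcs in an interval of length `2⁻ʳ`, over those `ξ` for which `|g| ≤ 2ⁿ` on
a dyadic interval of length `2⁻ʳ` close to the family. For one dyadic interval the set of such `ξ`
has volume `O(2^(nd) 2^(r d (d - 1) / 2))`, as the values of `g` at `d` equally spaced nodes depend on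
`ξ` through a Vandermonde matrix (`volume_abs_derivative_le`). With Minkowski's inequality in
`L^{p/2}` everything reduces to the inequalities `α p / 2 > d`, `α (p - 1) > d (d + 1) / 2` and
`p - 1 > d (d + 1) / 2`, which hold for `p > p_α`: the first is decisive for `d = 2`, the second
for `d ≥ 3`.

The limit `f` lies in `L^p`, and it is bounded, which settles `p = ∞`. By Fourier inversion its
distributional transform is the limit of the measures on the generations. Hence it is supported in
every generation, and it is nonzero since all these measures have total mass one.
-/

/-! ### The first-derivative van der Corput estimate -/

/-- The oscillatory integral `∫_a^b e^{2πi F(t)} dt` with polynomial phase `F`. -/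
noncomputable def oscInt (F : Polynomial ℝ) (a b : ℝ) : ℂ :=
  ∫ t in a..b, Complex.exp (2 * Real.pi * Complex.I * (F.eval t : ℝ))

lemma continuous_oscInt_integrand (F : Polynomial ℝ) :
    Continuous fun t : ℝ => Complex.exp (2 * Real.pi * Complex.I * (F.eval t : ℝ)) := by
  have := F.continuous
  fun_prop

lemma norm_oscInt_integrand (F : Polynomial ℝ) (t : ℝ) :
    ‖Complex.exp (2 * Real.pi * Complex.I * (F.eval t : ℝ))‖ = 1 := by
  have : (2 * Real.pi * Complex.I * (F.eval t : ℝ) : ℂ) =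
      ((2 * Real.pi * F.eval t : ℝ) : ℂ) * Complex.I := by push_cast; ring
  rw [this, Complex.norm_exp_ofReal_mul_I]

lemma oscInt_add (F : Polynomial ℝ) (a b c : ℝ) :
    oscInt F a b + oscInt F b c = oscInt F a c :=
  intervalIntegral.integral_add_adjacent_intervals
    ((continuous_oscInt_integrand F).intervalIntegrable _ _)
    ((continuous_oscInt_integrand F).intervalIntegrable _ _)

lemma norm_oscInt_le (F : Polynomial ℝ) {a b : ℝ} (hab : a ≤ b) : ‖oscInt F a b‖ ≤ b - a := by
  have := intervalIntegral.norm_integral_le_of_norm_le_const (a := a) (b := b) (C := 1)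
    (f := fun t : ℝ => Complex.exp (2 * Real.pi * Complex.I * (F.eval t : ℝ)))
    (fun t _ => (norm_oscInt_integrand F t).le)
  rwa [one_mul, abs_of_nonneg (by linarith)] at this

lemma norm_oscInt_neg (F : Polynomial ℝ) (a b : ℝ) : ‖oscInt (-F) a b‖ = ‖oscInt F a b‖ := by
  have : oscInt (-F) a b = (starRingEnd ℂ) (oscInt F a b) := by
    unfold oscInt
    rw [← intervalIntegral.intervalIntegral_conj]
    congr 1
    ext t
    rw [← Complex.exp_conj]
    congr 1
    simp only [Polynomial.eval_neg, map_mul, Complex.conj_I, Complex.conj_ofReal, map_ofNat]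
    push_cast
    ring
  rw [this, RCLike.norm_conj]

/-- First-derivative van der Corput estimate, for `F'` monotone in the direction given by `σ`. -/
lemma norm_oscInt_le_of_le_deriv (F : Polynomial ℝ) {a b lam : ℝ} (hab : a ≤ b) (hlam : 0 < lam)
    (hF : ∀ t ∈ Set.Ioo a b, lam ≤ F.derivative.eval t)
    {σ : ℝ} (hσ : σ = 1 ∨ σ = -1)
    (hF2 : ∀ t ∈ Set.Icc a b, 0 ≤ σ * F.derivative.derivative.eval t) :
    ‖oscInt F a b‖ ≤ 1 / lam := by
  rcases hab.eq_or_lt with rfl | hab'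
  · have := norm_oscInt_le F hab
    rw [sub_self] at this
    exact this.trans (by positivity)
  have hF' : ∀ t ∈ Set.Icc a b, lam ≤ F.derivative.eval t := by
    have hcl : IsClosed {t : ℝ | lam ≤ F.derivative.eval t} :=
      isClosed_le continuous_const F.derivative.continuous
    intro t ht
    rw [← closure_Ioo hab'.ne] at ht
    exact hcl.closure_subset_iff.2 (fun x hx => hF x hx) ht
  set g := F.derivative with hg
  have hpos : ∀ t ∈ Set.Icc a b, 0 < g.eval t := fun t ht => hlam.trans_le (hF' t ht)
  -- the integrand is `u v'` with `u = 1 / F'` and `v = e^{2πiF} / (2πi)`; as `u` is monotone, its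
  -- total variation is `|u a - u b|`
  let u : ℝ → ℝ := fun t => (g.eval t)⁻¹
  let u' : ℝ → ℝ := fun t => -(g.derivative.eval t) / (g.eval t) ^ 2
  let v : ℝ → ℂ := fun t =>
    Complex.exp (2 * Real.pi * Complex.I * (F.eval t : ℝ)) / (2 * Real.pi * Complex.I)
  let v' : ℝ → ℂ := fun t => (g.eval t : ℝ) * Complex.exp (2 * Real.pi * Complex.I * (F.eval t : ℝ))
  have hpi : (2 * Real.pi * Complex.I : ℂ) ≠ 0 := Complex.two_pi_I_ne_zero
  have hu : ∀ t ∈ Set.uIcc a b, HasDerivAt u (u' t) t := by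
    intro t ht
    rw [Set.uIcc_of_le hab] at ht
    exact (g.hasDerivAt t).inv (hpos t ht).ne'
  have huc : ∀ t ∈ Set.uIcc a b, HasDerivAt (fun t => (u t : ℂ)) (u' t : ℂ) t :=
    fun t ht => (hu t ht).ofReal_comp
  have hv : ∀ t ∈ Set.uIcc a b, HasDerivAt v (v' t) t := by
    intro t _
    have h1 : HasDerivAt (fun t : ℝ => ((F.eval t : ℝ) : ℂ)) ((g.eval t : ℝ) : ℂ) t :=
      (F.hasDerivAt t).ofReal_comp
    have h2 := ((h1.const_mul (2 * Real.pi * Complex.I : ℂ)).cexp).div_const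
      (2 * Real.pi * Complex.I : ℂ)
    refine h2.congr_deriv ?_
    rw [div_eq_iff hpi]
    simp only [v']
    ring
  have hu'c : ContinuousOn u' (Set.Icc a b) := by
    apply ContinuousOn.div
    · exact (g.derivative.continuous.neg).continuousOn
    · exact (g.continuous.pow 2).continuousOn
    · intro t ht; exact pow_ne_zero _ (hpos t ht).ne'
  have hu'i : IntervalIntegrable u' volume a b := by
    apply ContinuousOn.intervalIntegrable; rwa [Set.uIcc_of_le hab]
  have hu'ci : IntervalIntegrable (fun t => (u' t : ℂ)) volume a b := by
    apply ContinuousOn.intervalIntegrable; rw [Set.uIcc_of_le hab]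
    exact Complex.continuous_ofReal.comp_continuousOn hu'c
  have hv'i : IntervalIntegrable v' volume a b := by
    apply Continuous.intervalIntegrable
    exact (Complex.continuous_ofReal.comp g.continuous).mul (continuous_oscInt_integrand F)
  have hparts := intervalIntegral.integral_mul_deriv_eq_deriv_mul huc hv hu'ci hv'i
  have hosc : oscInt F a b = ∫ t in a..b, (u t : ℂ) * v' t := by
    unfold oscInt
    apply intervalIntegral.integral_congr
    intro t ht
    rw [Set.uIcc_of_le hab] at ht
    have : ((g.eval t : ℝ) : ℂ) ≠ 0 := by exact_mod_cast (hpos t ht).ne'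
    simp only [u, v']
    push_cast
    field_simp
  have hvn : ∀ t, ‖v t‖ = 1 / (2 * Real.pi) := by
    intro t
    simp only [v]
    rw [norm_div, norm_oscInt_integrand]
    simp [abs_of_pos Real.pi_pos]
  have hint : ‖∫ t in a..b, (u' t : ℂ) * v t‖ ≤ 1 / (2 * Real.pi) * (σ * (u a - u b)) := by
    have h1 : ‖∫ t in a..b, (u' t : ℂ) * v t‖ ≤ ∫ t in a..b, -(u' t) * (σ / (2 * Real.pi)) := by
      apply intervalIntegral.norm_integral_le_of_norm_le hab
      · filter_upwards with t ht
        have ht' : t ∈ Set.Icc a b := ⟨ht.1.le, ht.2⟩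
        have hsq : 0 < (g.eval t) ^ 2 := by have := hpos t ht'; positivity
        have habs : |u' t| = -(u' t) * σ := by
          have h0 : 0 ≤ -(u' t) * σ := by
            have : -(u' t) * σ = (σ * g.derivative.eval t) / (g.eval t) ^ 2 := by
              simp only [u']; ring
            rw [this]
            exact div_nonneg (hF2 t ht') hsq.le
          rcases hσ with rfl | rfl
          · rw [mul_one] at h0 ⊢
            exact abs_of_nonpos (by linarith)
          · rw [abs_of_nonneg (by linarith)]; ring
        rw [norm_mul, hvn, Complex.norm_real, Real.norm_eq_abs, habs]
        exact le_of_eq (by ring)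
      · exact (hu'i.neg).mul_const _
    have h2 : ∫ t in a..b, -(u' t) * (σ / (2 * Real.pi)) =
        1 / (2 * Real.pi) * (σ * (u a - u b)) := by
      rw [intervalIntegral.integral_mul_const, intervalIntegral.integral_neg,
        intervalIntegral.integral_eq_sub_of_hasDerivAt hu hu'i]
      ring
    rwa [h2] at h1
  have hua : u a ≤ 1 / lam := by
    change (g.eval a)⁻¹ ≤ 1 / lam
    rw [← one_div]
    exact one_div_le_one_div_of_le hlam (hF' a ⟨le_rfl, hab⟩)
  have hua0 : 0 ≤ u a := inv_nonneg.2 (hpos a ⟨le_rfl, hab⟩).le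
  have hub0 : 0 ≤ u b := inv_nonneg.2 (hpos b ⟨hab, le_rfl⟩).le
  have hub : u b ≤ 1 / lam := by
    change (g.eval b)⁻¹ ≤ 1 / lam
    rw [← one_div]
    exact one_div_le_one_div_of_le hlam (hF' b ⟨hab, le_rfl⟩)
  rw [hosc, hparts]
  calc _ ≤ ‖(u b : ℂ) * v b‖ + ‖(u a : ℂ) * v a‖ + ‖∫ t in a..b, (u' t : ℂ) * v t‖ := by
        exact (norm_sub_le _ _).trans (by gcongr; exact norm_sub_le _ _)
    _ ≤ u b * (1 / (2 * Real.pi)) + u a * (1 / (2 * Real.pi)) +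
          1 / (2 * Real.pi) * (σ * (u a - u b)) := by
        gcongr
        · rw [norm_mul, hvn, Complex.norm_real, Real.norm_of_nonneg hub0]
        · rw [norm_mul, hvn, Complex.norm_real, Real.norm_of_nonneg hua0]
    _ = (u a + u b + σ * (u a - u b)) / 2 * (1 / Real.pi) := by ring
    _ ≤ 1 / lam * 1 := by
        refine mul_le_mul ?_ ?_ (by positivity) (by positivity)
        · rcases hσ with rfl | rfl <;> linarith
        · rw [div_le_one Real.pi_pos]; linarith [Real.pi_gt_three]
    _ = 1 / lam := mul_one _

/-- A continuous monotone function crosses a level at a single place. -/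
lemma MonotoneOn.exists_threshold {g : ℝ → ℝ} {u v : ℝ} (huv : u ≤ v)
    (hg : MonotoneOn g (Set.Icc u v)) (hc : ContinuousOn g (Set.Icc u v)) (y : ℝ) :
    ∃ c ∈ Set.Icc u v, (∀ t ∈ Set.Icc u v, t < c → g t ≤ y) ∧
      (∀ t ∈ Set.Icc u v, c < t → y ≤ g t) := by
  have hu : u ∈ Set.Icc u v := ⟨le_rfl, huv⟩
  have hv : v ∈ Set.Icc u v := ⟨huv, le_rfl⟩
  by_cases h1 : y ≤ g u
  · exact ⟨u, hu, fun t ht htu => absurd ht.1 (not_le.2 htu),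
      fun t ht _ => h1.trans (hg hu ht ht.1)⟩
  by_cases h2 : g v ≤ y
  · exact ⟨v, hv, fun t ht _ => (hg ht hv ht.2).trans h2, fun t ht htv => absurd ht.2 (not_le.2 htv)⟩
  push Not at h1 h2
  obtain ⟨c, hcm, rfl⟩ := intermediate_value_Icc huv hc ⟨h1.le, h2.le⟩
  exact ⟨c, hcm, fun t ht h => hg ht hcm h.le, fun t ht h => hg hcm ht h.le⟩

/-- Where `F''` is nonnegative, the set `{|F'| ≤ lam}` is an interval, and the oscillatory integral
over any subinterval is controlled by the part of it in that set. -/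
lemma exists_slow_interval (F : Polynomial ℝ) {u v lam : ℝ} (huv : u ≤ v) (hlam : 0 < lam)
    (hF2 : ∀ t ∈ Set.Icc u v, 0 ≤ F.derivative.derivative.eval t) :
    ∃ c c', c ∈ Set.Icc u v ∧ c' ∈ Set.Icc u v ∧ c ≤ c' ∧
      (∀ t ∈ Set.Ioo c c', |F.derivative.eval t| ≤ lam) ∧
      (∀ t ∈ Set.Icc u v, t < c → F.derivative.eval t ≤ -lam) ∧
      (∀ t ∈ Set.Icc u v, c' < t → lam ≤ F.derivative.eval t) ∧
      ∀ a b, u ≤ a → a ≤ b → b ≤ v →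
        ‖oscInt F a b‖ ≤ 2 / lam + (c' - c) ∧
        ((∀ x ∈ Set.Ioo a b, x ∉ Set.Ioo c c') → ‖oscInt F a b‖ ≤ 2 / lam) := by
  have hmono : MonotoneOn (fun t => F.derivative.eval t) (Set.Icc u v) := by
    apply monotoneOn_of_deriv_nonneg (convex_Icc u v) F.derivative.continuous.continuousOn
      F.derivative.differentiable.differentiableOn
    intro t ht
    rw [Polynomial.deriv]
    exact hF2 t (interior_subset ht)
  obtain ⟨c, hc, hc1, hc2⟩ := hmono.exists_threshold huv F.derivative.continuous.continuousOn (-lam)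
  obtain ⟨c', hc', hc1', hc2'⟩ := hmono.exists_threshold huv F.derivative.continuous.continuousOn lam
  have hcc : c ≤ c' := by
    by_contra! h
    have hm : (c + c') / 2 ∈ Set.Icc u v :=
      ⟨by linarith [hc.1, hc'.1], by linarith [hc.2, hc'.2]⟩
    have := hc1 _ hm (by linarith)
    have := hc2' _ hm (by linarith)
    linarith
  refine ⟨c, c', hc, hc', hcc, ?_, hc1, hc2', ?_⟩
  · intro t ht
    have hm : t ∈ Set.Icc u v := ⟨hc.1.trans ht.1.le, ht.2.le.trans hc'.2⟩
    rw [abs_le]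
    exact ⟨hc2 t hm ht.1, hc1' t hm ht.2⟩
  · intro a b hua hab hbv
    set x := max a (min b c) with hx
    set y := max a (min b c') with hy
    have hax : a ≤ x := le_max_left _ _
    have hxy : x ≤ y := max_le_max le_rfl (min_le_min le_rfl hcc)
    have hyb : y ≤ b := max_le hab (min_le_left _ _)
    have h1 : ‖oscInt F a x‖ ≤ 1 / lam := by
      rw [← norm_oscInt_neg]
      apply norm_oscInt_le_of_le_deriv _ hax hlam (σ := -1) ?_ (Or.inr rfl)
      · intro t ht
        have := hF2 t ⟨hua.trans ht.1, ht.2.trans ((hxy.trans hyb).trans hbv)⟩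
        simpa using this
      · intro t ht
        have htc : t < c := by
          rcases lt_max_iff.1 ht.2 with h | h
          · exact absurd ht.1 (not_lt.2 h.le)
          · exact h.trans_le (min_le_right _ _)
        have := hc1 t ⟨hua.trans ht.1.le, (ht.2.le.trans (hxy.trans hyb)).trans hbv⟩ htc
        rw [Polynomial.derivative_neg, Polynomial.eval_neg]
        linarith
    have h3 : ‖oscInt F y b‖ ≤ 1 / lam := by
      apply norm_oscInt_le_of_le_deriv _ hyb hlam (σ := 1) ?_ (Or.inl rfl)
      · intro t ht
        rw [one_mul]
        exact hF2 t ⟨hua.trans ((hax.trans hxy).trans ht.1), ht.2.trans hbv⟩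
      · intro t ht
        apply hc2' t ⟨hua.trans ((hax.trans hxy).trans ht.1.le), ht.2.le.trans hbv⟩
        by_contra! h
        exact absurd ht.1 (not_lt.2 ((le_min ht.2.le h).trans (le_max_right _ _)))
    have h2 : ‖oscInt F x y‖ ≤ y - x := norm_oscInt_le F hxy
    have hsum : ‖oscInt F a b‖ ≤ 1 / lam + (y - x) + 1 / lam := by
      rw [← oscInt_add F a y b, ← oscInt_add F a x y]
      exact (norm_add_le _ _).trans (add_le_add ((norm_add_le _ _).trans (add_le_add h1 h2)) h3)
    have h2l : 2 / lam = 1 / lam + 1 / lam := by ring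
    constructor
    · have : y - x ≤ c' - c := by
        rw [hx, hy]
        rcases le_total b c with h | h <;> rcases le_total b c' with h' | h' <;>
        simp only [min_eq_left, min_eq_right, h, h'] <;>
        simp only [max_def] <;> split_ifs <;> linarith
      linarith
    · intro hdis
      have : y - x ≤ 0 := by
        by_contra! h
        have hxy' : x < y := by linarith
        refine hdis ((x + y) / 2) ⟨by linarith, by linarith⟩ ⟨?_, ?_⟩
        · rcases le_total b c with h' | h'
          · have : x = b := by rw [hx, min_eq_left h', max_eq_right hab]
            linarith
          · have : c ≤ x := by rw [hx, min_eq_right h']; exact le_max_right _ _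
            linarith
        · rcases lt_max_iff.1 (show (x+y)/2 < max a (min b c') by rw [← hy]; linarith) with h' | h'
          · linarith
          · exact h'.trans_le (min_le_right _ _)
      linarith

/-! ### Dyadic intervals on which the phase is slow -/

/-- The indices of the dyadic intervals of length `2⁻ʳ` that contain (for `r ≤ k`) or are contained
in (for `r > k`) some interval `[i / 2ᵏ, (i + 1) / 2ᵏ]` with `i ∈ S`. -/
def dyadicLevel (k : ℕ) (S : Finset ℕ) (r : ℕ) : Finset ℕ :=
  if r ≤ k then S.image (· / 2 ^ (k - r))
  else S.biUnion fun i => Finset.Ico (i * 2 ^ (r - k)) ((i + 1) * 2 ^ (r - k))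

/-- `|F'| ≤ 2ⁿ` on some dyadic interval of length `2⁻ʳ` at distance `O(2⁻ʳ)` from one of the
dyadic intervals indexed by `S`. -/
def SlowNear (k : ℕ) (S : Finset ℕ) (n r : ℕ) (F : Polynomial ℝ) : Prop :=
  ∃ j ∈ dyadicLevel k S r, ∃ c ∈ Finset.range 11,
    ∀ t ∈ Set.Ioo (((j : ℝ) + c - 5) / 2 ^ r) (((j : ℝ) + c - 4) / 2 ^ r),
      |F.derivative.eval t| ≤ 2 ^ n

lemma ancestor_mem_Ico {k r i : ℕ} (hr : r ≤ k) {c c' x : ℝ} (hc0 : 0 ≤ c)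
    (hcc : c' - c ≤ 4 / 2 ^ r) (hx : x ∈ Set.Ioo ((i : ℝ) / 2 ^ k) ((i + 1) / 2 ^ k))
    (hx' : x ∈ Set.Ioo c c') :
    i / 2 ^ (k - r) ∈ Finset.Ico ⌊c * 2 ^ r⌋₊ (⌊c * 2 ^ r⌋₊ + 5) := by
  have h2r : (0 : ℝ) < 2 ^ r := by positivity
  have h2k : (0 : ℝ) < 2 ^ k := by positivity
  have h2kr : (0 : ℝ) < 2 ^ (k - r) := by positivity
  have hk : (2 : ℝ) ^ k = 2 ^ (k - r) * 2 ^ r := by rw [← pow_add]; congr 1; omega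
  set a := i / 2 ^ (k - r) with ha
  have h1 : a * 2 ^ (k - r) ≤ i := Nat.div_mul_le_self _ _
  have h2 : i + 1 ≤ (a + 1) * 2 ^ (k - r) := by
    have := Nat.lt_div_mul_add (a := i) (b := 2 ^ (k - r)) (by positivity)
    rw [← ha] at this
    rw [add_mul, one_mul]; omega
  have h1' : (a : ℝ) * 2 ^ (k - r) ≤ i := by exact_mod_cast h1
  have h2' : (i : ℝ) + 1 ≤ ((a : ℝ) + 1) * 2 ^ (k - r) := by exact_mod_cast h2
  have hx1 : (i : ℝ) < x * 2 ^ k := by have := hx.1; rwa [div_lt_iff₀ h2k] at this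
  have hx2 : x * 2 ^ k < i + 1 := by have := hx.2; rwa [lt_div_iff₀ h2k] at this
  have hxa1 : (a : ℝ) < x * 2 ^ r := by
    by_contra! h
    have := mul_le_mul_of_nonneg_right h h2kr.le
    rw [hk] at hx1; nlinarith
  have hxa2 : x * 2 ^ r < a + 1 := by
    by_contra! h
    have := mul_le_mul_of_nonneg_right h h2kr.le
    rw [hk] at hx2; nlinarith
  have hc4 : c' * 2 ^ r ≤ c * 2 ^ r + 4 := by
    rw [le_div_iff₀ h2r] at hcc; linarith
  have hxc := mul_lt_mul_of_pos_right hx'.1 h2r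
  have hxc' := mul_lt_mul_of_pos_right hx'.2 h2r
  rw [Finset.mem_Ico]
  constructor
  · have : ⌊c * 2 ^ r⌋₊ < a + 1 := by
      rw [Nat.floor_lt (by positivity)]; push_cast; linarith
    omega
  · have h3 := Nat.lt_floor_add_one (c * 2 ^ r)
    have : (a : ℝ) < (⌊c * 2 ^ r⌋₊ + 5 : ℕ) := by push_cast; linarith
    exact_mod_cast this

open Classical in
lemma card_meeting_le {k : ℕ} {S : Finset ℕ} {m : ℕ → ℕ}
    (hm : ∀ r ≤ k, ∀ j, (S.filter (· / 2 ^ (k - r) = j)).card ≤ m r) (hm1 : ∀ r, k < r → 1 ≤ m r)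
    {r : ℕ} {c c' : ℝ} (hc0 : 0 ≤ c) (hcc : c' - c ≤ 4 / 2 ^ r) :
    (S.filter fun i : ℕ => ∃ x ∈ Set.Ioo ((i : ℝ) / 2 ^ k) ((i + 1) / 2 ^ k),
      x ∈ Set.Ioo c c').card ≤ 5 * m r := by
  rcases le_or_gt r k with hr | hr
  · calc _ ≤ ((Finset.Ico ⌊c * 2 ^ r⌋₊ (⌊c * 2 ^ r⌋₊ + 5)).biUnion
          fun j => S.filter (· / 2 ^ (k - r) = j)).card := by
          apply Finset.card_le_card
          intro i hi
          obtain ⟨hiS, x, hx, hx'⟩ := Finset.mem_filter.1 hi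
          rw [Finset.mem_biUnion]
          exact ⟨_, ancestor_mem_Ico hr hc0 hcc hx hx', Finset.mem_filter.2 ⟨hiS, rfl⟩⟩
      _ ≤ (Finset.Ico ⌊c * 2 ^ r⌋₊ (⌊c * 2 ^ r⌋₊ + 5)).card * m r :=
          Finset.card_biUnion_le_card_mul _ _ _ fun j _ => hm r hr j
      _ = 5 * m r := by simp
  · have hcc' : c' - c ≤ 4 / 2 ^ k := hcc.trans (by
      gcongr
      norm_num)
    calc _ ≤ (Finset.Ico ⌊c * 2 ^ k⌋₊ (⌊c * 2 ^ k⌋₊ + 5)).card := by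
          apply Finset.card_le_card
          intro i hi
          obtain ⟨hiS, x, hx, hx'⟩ := Finset.mem_filter.1 hi
          simpa using ancestor_mem_Ico le_rfl hc0 hcc' hx hx'
      _ = 5 := by simp
      _ ≤ 5 * m r := by have := hm1 r hr; omega

lemma slowNear_of_interval {k : ℕ} {S : Finset ℕ} {n r i : ℕ} {F : Polynomial ℝ} (hi : i ∈ S)
    {c c' x : ℝ} (hc0 : 0 ≤ c) (hcc : c' - c ≤ 4 / 2 ^ r) (hcc' : 2 / 2 ^ r ≤ c' - c)
    (hF : ∀ t ∈ Set.Ioo c c', |F.derivative.eval t| ≤ 2 ^ n)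
    (hx : x ∈ Set.Ioo ((i : ℝ) / 2 ^ k) ((i + 1) / 2 ^ k)) (hx' : x ∈ Set.Ioo c c') :
    SlowNear k S n r F := by
  have h2r : (0 : ℝ) < 2 ^ r := by positivity
  have h2k : (0 : ℝ) < 2 ^ k := by positivity
  obtain ⟨a, haL, ha⟩ : ∃ a ∈ dyadicLevel k S r,
      a ∈ Finset.Ico ⌊c * 2 ^ r⌋₊ (⌊c * 2 ^ r⌋₊ + 5) := by
    rcases le_or_gt r k with hr | hr
    · refine ⟨_, ?_, ancestor_mem_Ico hr hc0 hcc hx hx'⟩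
      rw [dyadicLevel, if_pos hr]
      exact Finset.mem_image_of_mem _ hi
    · have hk : (2 : ℝ) ^ r = 2 ^ (r - k) * 2 ^ k := by rw [← pow_add]; congr 1; omega
      have hx0 : 0 ≤ x := hc0.trans hx'.1.le
      have hx1 : (i : ℝ) < x * 2 ^ k := by have := hx.1; rwa [div_lt_iff₀ h2k] at this
      have hx2 : x * 2 ^ k < i + 1 := by have := hx.2; rwa [lt_div_iff₀ h2k] at this
      have h2rk : (0 : ℝ) < 2 ^ (r - k) := by positivity
      refine ⟨⌊x * 2 ^ r⌋₊, ?_, ?_⟩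
      · rw [dyadicLevel, if_neg (not_le.2 hr), Finset.mem_biUnion]
        refine ⟨i, hi, Finset.mem_Ico.2 ⟨?_, ?_⟩⟩
        · apply Nat.le_floor
          push_cast
          rw [hk]; nlinarith
        · rw [Nat.floor_lt (by positivity)]
          push_cast
          rw [hk]; nlinarith
      · have hc4 : c' * 2 ^ r ≤ c * 2 ^ r + 4 := by
          rw [le_div_iff₀ h2r] at hcc; linarith
        have hxc := mul_lt_mul_of_pos_right hx'.1 h2r
        have hxc' := mul_lt_mul_of_pos_right hx'.2 h2r
        rw [Finset.mem_Ico]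
        refine ⟨Nat.floor_le_floor hxc.le, ?_⟩
        rw [Nat.floor_lt (by positivity)]
        have h3 := Nat.lt_floor_add_one (c * 2 ^ r)
        push_cast; linarith
  rw [Finset.mem_Ico] at ha
  set a0 := ⌊c * 2 ^ r⌋₊ with ha0
  refine ⟨a, haL, a0 + 6 - a, Finset.mem_range.2 (by omega), ?_⟩
  have h1 : (((a0 + 6 - a : ℕ)) : ℝ) = a0 + 6 - a := by
    rw [Nat.cast_sub (by omega)]; push_cast; ring
  have hfl : (a0 : ℝ) ≤ c * 2 ^ r := Nat.floor_le (by positivity)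
  have hfl' := Nat.lt_floor_add_one (c * 2 ^ r)
  rw [← ha0] at hfl'
  intro t ht
  rw [h1] at ht
  apply hF
  rw [div_le_iff₀ h2r] at hcc'
  constructor
  · have := ht.1
    rw [div_lt_iff₀ h2r] at this
    exact lt_of_mul_lt_mul_right (by linarith) h2r.le
  · have := ht.2
    rw [lt_div_iff₀ h2r] at this
    exact lt_of_mul_lt_mul_right (by linarith) h2r.le

lemma exists_dyadic_scale {κ : ℝ} {n : ℕ} (hκ : 4 / 2 ^ n ≤ κ) (hκ1 : κ ≤ 1) :
    ∃ r ≤ n, 2 / 2 ^ r ≤ κ ∧ κ ≤ 4 / 2 ^ r := by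
  classical
  have hex : ∃ r : ℕ, 2 / 2 ^ r ≤ κ := ⟨n, le_trans (by gcongr; norm_num) hκ⟩
  refine ⟨Nat.find hex, Nat.find_min' hex (le_trans (by gcongr; norm_num) hκ), Nat.find_spec hex, ?_⟩
  have h0 : Nat.find hex ≠ 0 := by
    intro h
    have := Nat.find_spec hex
    rw [h] at this
    norm_num at this
    linarith
  obtain ⟨s, hs⟩ := Nat.exists_eq_succ_of_ne_zero h0
  have hlt := Nat.find_min hex (m := s) (by omega)
  push Not at hlt
  rw [hs, Nat.succ_eq_add_one, pow_succ]
  have : (4 : ℝ) / (2 ^ s * 2) = 2 / 2 ^ s := by field_simp; norm_num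
  linarith

/-- The multiscale majorant of the square function of the arcs indexed by `S`: the scales `2⁻ⁿ`,
`n ≥ k`, weighted by `4⁻ⁿ` times the number `m r` of arcs that an interval of length `2⁻ʳ`
can meet. -/
noncomputable def slowMajorant (k : ℕ) (S : Finset ℕ) (m : ℕ → ℕ) (F : Polynomial ℝ) : ℝ≥0∞ :=
  ∑' l : ℕ, ∑ r ∈ Finset.range (k + l + 1),
    (4⁻¹ : ℝ≥0∞) ^ (k + l) * {G | SlowNear k S (k + l) r G}.indicator (fun _ => (m r : ℝ≥0∞)) F

/-- The retraction of the line onto `[u, v]`. -/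
noncomputable def clampTo (u v x : ℝ) : ℝ := max u (min v x)

lemma clampTo_mono (u v : ℝ) : Monotone (clampTo u v) :=
  fun _ _ h => max_le_max le_rfl (min_le_min le_rfl h)

lemma le_clampTo (u v x : ℝ) : u ≤ clampTo u v x := le_max_left _ _

lemma clampTo_le {u v : ℝ} (h : u ≤ v) (x : ℝ) : clampTo u v x ≤ v := max_le h (min_le_left _ _)

lemma mem_Ioo_of_clampTo {u v a b x : ℝ} (huv : u ≤ v)
    (hx : x ∈ Set.Ioo (clampTo u v a) (clampTo u v b)) : x ∈ Set.Ioo a b := by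
  obtain ⟨h1, h2⟩ := hx
  constructor
  · by_contra! h
    have h3 : x < v := h2.trans_le (clampTo_le huv b)
    exact absurd h1 (not_lt.2 ((le_min h3.le h).trans (le_max_right _ _)))
  · rcases lt_max_iff.1 h2 with h | h
    · exact absurd ((le_clampTo u v a).trans_lt h1) (not_lt.2 h.le)
    · exact h.trans_le (min_le_right _ _)

lemma clampTo_sub_le (u v : ℝ) {a b : ℝ} (hab : a ≤ b) : clampTo u v b - clampTo u v a ≤ b - a := by
  unfold clampTo
  simp only [max_def, min_def]
  split_ifs <;> linarith

/-! ### Pointwise bound for the square function -/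

/-- The square function of the arcs `[i / 2ᵏ, (i + 1) / 2ᵏ] ∩ [u, v]`, `i ∈ S`. -/
noncomputable def arcSquareSum (k : ℕ) (S : Finset ℕ) (F : Polynomial ℝ) (u v : ℝ) : ℝ≥0∞ :=
  ∑ i ∈ S, ENNReal.ofReal
    (‖oscInt F (clampTo u v ((i : ℝ) / 2 ^ k)) (clampTo u v ((i + 1) / 2 ^ k))‖ ^ 2)

lemma dyadic_le (k i : ℕ) : (i : ℝ) / 2 ^ k ≤ (i + 1) / 2 ^ k := by gcongr; linarith

lemma dyadic_sub (k i : ℕ) : ((i : ℝ) + 1) / 2 ^ k - i / 2 ^ k = 1 / 2 ^ k := by ring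

open Classical in
/-- An arc is bounded by `12 / 2ⁿ` for the first scale `n` at which it meets a long interval on
which `|F'| ≤ 2ⁿ`; those intervals depend only on `n`. -/
lemma exists_good_scales (k : ℕ) (F : Polynomial ℝ) {u v : ℝ} (huv : u ≤ v)
    (hF2 : ∀ t ∈ Set.Icc u v, 0 ≤ F.derivative.derivative.eval t) :
    ∃ c c' : ℕ → ℝ, (∀ n, u ≤ c n ∧ c' n ≤ v) ∧
      (∀ n, ∀ t ∈ Set.Ioo (c n) (c' n), |F.derivative.eval t| ≤ 2 ^ n) ∧
      ∀ i : ℕ, oscInt F (clampTo u v ((i : ℝ) / 2 ^ k)) (clampTo u v ((i + 1) / 2 ^ k)) = 0 ∨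
        ∃ n, k ≤ n ∧ 4 / 2 ^ n ≤ c' n - c n ∧
          (∃ x ∈ Set.Ioo ((i : ℝ) / 2 ^ k) ((i + 1) / 2 ^ k), x ∈ Set.Ioo (c n) (c' n)) ∧
          ‖oscInt F (clampTo u v ((i : ℝ) / 2 ^ k)) (clampTo u v ((i + 1) / 2 ^ k))‖ ≤
            12 / 2 ^ n := by
  choose c c' hc hc' hcc hslow hlow hhigh hosc using fun n : ℕ =>
    exists_slow_interval F huv (lam := 2 ^ n) (by positivity) hF2
  refine ⟨c, c', fun n => ⟨(hc n).1, (hc' n).2⟩, hslow, fun i => ?_⟩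
  set a := clampTo u v ((i : ℝ) / 2 ^ k) with ha
  set b := clampTo u v (((i : ℝ) + 1) / 2 ^ k) with hb
  have hab : a ≤ b := clampTo_mono u v (dyadic_le k i)
  rcases hab.eq_or_lt with hab' | hab'
  · left; rw [← hab', oscInt, intervalIntegral.integral_same]
  right
  have hua : u ≤ a := le_clampTo _ _ _
  have hbv : b ≤ v := clampTo_le huv _
  have huv' : u < v := hua.trans_lt (hab'.trans_le hbv)
  -- for large `n` the slow interval is all of `[u, v]`, so a good scale exists
  have hex : ∃ n, k ≤ n ∧ 4 / 2 ^ n ≤ c' n - c n ∧ ∃ x ∈ Set.Ioo a b, x ∈ Set.Ioo (c n) (c' n) := by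
    obtain ⟨n1, hn1⟩ := pow_unbounded_of_one_lt (max |F.derivative.eval u| |F.derivative.eval v|)
      (one_lt_two : (1 : ℝ) < 2)
    obtain ⟨n2, hn2⟩ := pow_unbounded_of_one_lt (4 / (v - u)) (one_lt_two : (1 : ℝ) < 2)
    set n := max k (max n1 n2) with hn
    have h1 : (2 : ℝ) ^ n1 ≤ 2 ^ n := by gcongr <;> simp [hn]
    have h2 : (2 : ℝ) ^ n2 ≤ 2 ^ n := by gcongr <;> simp [hn]
    have hcu : c n = u := by
      refine le_antisymm ?_ (hc n).1
      by_contra! h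
      have h3 := hlow n u ⟨le_rfl, huv⟩ h
      have h4 := neg_abs_le (F.derivative.eval u)
      have h5 := le_max_left |F.derivative.eval u| |F.derivative.eval v|
      linarith
    have hcv : c' n = v := by
      refine le_antisymm (hc' n).2 ?_
      by_contra! h
      have h3 := hhigh n v ⟨huv, le_rfl⟩ h
      have h4 := le_abs_self (F.derivative.eval v)
      have h5 := le_max_right |F.derivative.eval u| |F.derivative.eval v|
      linarith
    refine ⟨n, le_max_left _ _, ?_, (a + b) / 2, ⟨by linarith, by linarith⟩, ?_⟩
    · rw [hcu, hcv, div_le_iff₀ (by positivity)]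
      rw [div_lt_iff₀ (by linarith)] at hn2
      nlinarith
    · rw [hcu, hcv]; constructor <;> linarith
  obtain ⟨hkn, hlen, x, hx, hx'⟩ := Nat.find_spec hex
  have hmin := fun s => Nat.find_min hex (m := s)
  set n := Nat.find hex with hn
  refine ⟨n, hkn, hlen, ⟨x, mem_Ioo_of_clampTo huv hx, hx'⟩, ?_⟩
  rcases hkn.eq_or_lt with h | h
  · calc _ ≤ b - a := norm_oscInt_le F hab
      _ ≤ 1 / 2 ^ k := by
        rw [← dyadic_sub k i]; exact clampTo_sub_le u v (dyadic_le k i)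
      _ ≤ 12 / 2 ^ n := by rw [← h]; gcongr; norm_num
  · -- at the scale before the first good one, the slow part of the arc is short or empty
    obtain ⟨s, hs⟩ : ∃ s, n = s + 1 := ⟨n - 1, by omega⟩
    have hns := hmin s (by omega)
    have h2s : (0 : ℝ) < 2 ^ s := by positivity
    have e12 : (12 : ℝ) / 2 ^ n = 2 / 2 ^ s + 4 / 2 ^ s := by
      rw [hs, pow_succ]; field_simp; norm_num
    have hpos : (0 : ℝ) < 4 / 2 ^ s := by positivity
    rw [e12]
    by_cases hmeet : ∃ x ∈ Set.Ioo a b, x ∈ Set.Ioo (c s) (c' s)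
    · have hshort : c' s - c s < 4 / 2 ^ s := by
        by_contra! h'
        exact hns ⟨by omega, h', hmeet⟩
      have := (hosc s a b hua hab hbv).1
      linarith
    · push Not at hmeet
      have := (hosc s a b hua hab hbv).2 hmeet
      linarith

open Classical in
lemma arcSquareSum_le_of_nonneg {k : ℕ} {S : Finset ℕ} {m : ℕ → ℕ}
    (hm : ∀ r ≤ k, ∀ j, (S.filter (· / 2 ^ (k - r) = j)).card ≤ m r) (hm1 : ∀ r, k < r → 1 ≤ m r)
    (F : Polynomial ℝ) {u v : ℝ} (hu : 0 ≤ u) (huv : u ≤ v) (hv : v ≤ 1)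
    (hF2 : ∀ t ∈ Set.Icc u v, 0 ≤ F.derivative.derivative.eval t) :
    arcSquareSum k S F u v ≤ 720 * slowMajorant k S m F := by
  obtain ⟨c, c', hcc, hslow, hosc⟩ := exists_good_scales k F huv hF2
  let meets : ℕ → ℕ → Prop := fun n i =>
    ∃ x ∈ Set.Ioo ((i : ℝ) / 2 ^ k) ((i + 1) / 2 ^ k), x ∈ Set.Ioo (c n) (c' n)
  let good : ℕ → Prop := fun n => 4 / 2 ^ n ≤ c' n - c n
  have hterm : ∀ i ∈ S, ENNReal.ofReal
      (‖oscInt F (clampTo u v ((i : ℝ) / 2 ^ k)) (clampTo u v ((i + 1) / 2 ^ k))‖ ^ 2) ≤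
      ∑' l : ℕ, if good (k + l) ∧ meets (k + l) i then 144 * (4⁻¹ : ℝ≥0∞) ^ (k + l) else 0 := by
    intro i _
    rcases hosc i with h | ⟨n, hkn, hg, hmt, hle⟩
    · rw [h]; simp
    · obtain ⟨l, rfl⟩ := Nat.exists_eq_add_of_le hkn
      refine le_trans ?_ (ENNReal.le_tsum l)
      rw [if_pos ⟨hg, hmt⟩]
      calc ENNReal.ofReal (_ ^ 2) ≤ ENNReal.ofReal ((12 / 2 ^ (k + l)) ^ 2) := by gcongr
        _ = ENNReal.ofReal (144 * (4⁻¹) ^ (k + l)) := by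
          congr 1
          rw [div_pow, ← pow_mul, mul_comm (k + l) 2, pow_mul, inv_pow, div_eq_mul_inv]
          norm_num
        _ = _ := by
          rw [ENNReal.ofReal_mul (by norm_num), ENNReal.ofReal_pow (by norm_num),
            ENNReal.ofReal_inv_of_pos (by norm_num)]
          norm_num
  calc arcSquareSum k S F u v ≤ ∑ i ∈ S, ∑' l : ℕ,
        if good (k + l) ∧ meets (k + l) i then 144 * (4⁻¹ : ℝ≥0∞) ^ (k + l) else 0 :=
        Finset.sum_le_sum hterm
    _ = ∑' l : ℕ, ∑ i ∈ S,
        if good (k + l) ∧ meets (k + l) i then 144 * (4⁻¹ : ℝ≥0∞) ^ (k + l) else 0 :=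
        (Summable.tsum_finsetSum fun _ _ => ENNReal.summable).symm
    _ ≤ ∑' l : ℕ, 720 * ∑ r ∈ Finset.range (k + l + 1), (4⁻¹ : ℝ≥0∞) ^ (k + l) *
          {G | SlowNear k S (k + l) r G}.indicator (fun _ => (m r : ℝ≥0∞)) F := by
        refine ENNReal.tsum_le_tsum fun l => ?_
        by_cases hgood : good (k + l)
        swap
        · simp [hgood]
        obtain ⟨r, hr, hr1, hr2⟩ := exists_dyadic_scale hgood (by linarith [hcc (k + l)])
        have hcard := card_meeting_le hm hm1 (hu.trans (hcc (k + l)).1) hr2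
        have hsum : (∑ i ∈ S,
            if good (k + l) ∧ meets (k + l) i then 144 * (4⁻¹ : ℝ≥0∞) ^ (k + l) else 0) =
            ((S.filter (meets (k + l))).card : ℝ≥0∞) * (144 * (4⁻¹ : ℝ≥0∞) ^ (k + l)) := by
          simp only [hgood, true_and]
          rw [← Finset.sum_filter, Finset.sum_const, nsmul_eq_mul]
        rw [hsum]
        rcases (S.filter (meets (k + l))).eq_empty_or_nonempty with he | ⟨i, hi⟩
        · rw [he]; simp
        obtain ⟨hiS, x, hx, hx'⟩ := Finset.mem_filter.1 hi
        have hs : SlowNear k S (k + l) r F :=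
          slowNear_of_interval hiS (hu.trans (hcc (k + l)).1) hr2 hr1 (hslow _) hx hx'
        calc _ ≤ ((5 * m r : ℕ) : ℝ≥0∞) * (144 * (4⁻¹ : ℝ≥0∞) ^ (k + l)) := by
              gcongr
          _ = 720 * ((4⁻¹ : ℝ≥0∞) ^ (k + l) *
              {G | SlowNear k S (k + l) r G}.indicator (fun _ => (m r : ℝ≥0∞)) F) := by
              rw [Set.indicator_of_mem (show F ∈ {G | SlowNear k S (k + l) r G} from hs)]
              push_cast
              rw [show (720 : ℝ≥0∞) = 5 * 144 by norm_num]
              ring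
          _ ≤ _ := by
              gcongr
              exact Finset.single_le_sum (f := fun r => (4⁻¹ : ℝ≥0∞) ^ (k + l) *
                {G | SlowNear k S (k + l) r G}.indicator (fun _ => (m r : ℝ≥0∞)) F)
                (fun _ _ => zero_le) (Finset.mem_range.2 (by omega))
    _ = 720 * slowMajorant k S m F := by rw [slowMajorant, ENNReal.tsum_mul_left]

lemma slowMajorant_neg (k : ℕ) (S : Finset ℕ) (m : ℕ → ℕ) (F : Polynomial ℝ) :
    slowMajorant k S m (-F) = slowMajorant k S m F := by
  have h : ∀ n r, SlowNear k S n r (-F) ↔ SlowNear k S n r F := by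
    intro n r; simp [SlowNear]
  refine tsum_congr fun l => Finset.sum_congr rfl fun r _ => ?_
  congr 1
  by_cases hs : SlowNear k S (k + l) r F
  · rw [Set.indicator_of_mem (by exact (h _ _).2 hs), Set.indicator_of_mem (by exact hs)]
  · rw [Set.indicator_of_notMem (by exact fun h' => hs ((h _ _).1 h')),
      Set.indicator_of_notMem (by exact hs)]

lemma arcSquareSum_neg (k : ℕ) (S : Finset ℕ) (F : Polynomial ℝ) (u v : ℝ) :
    arcSquareSum k S (-F) u v = arcSquareSum k S F u v := by
  simp only [arcSquareSum, norm_oscInt_neg]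

lemma oscInt_clampTo_split (F : Polynomial ℝ) {u w v : ℝ} (huw : u ≤ w) (hwv : w ≤ v) (a b : ℝ) :
    oscInt F (clampTo u v a) (clampTo u v b) =
      oscInt F (clampTo u w a) (clampTo u w b) + oscInt F (clampTo w v a) (clampTo w v b) := by
  have key : ∀ x, oscInt F u (clampTo u v x) =
      oscInt F u (clampTo u w x) + oscInt F w (clampTo w v x) := by
    intro x
    rcases le_total x w with h | h
    · have h1 : clampTo u v x = clampTo u w x := by
        rw [clampTo, clampTo, min_eq_right h, min_eq_right (h.trans hwv)]
      have h2 : clampTo w v x = w := by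
        rw [clampTo, max_eq_left ((min_le_right _ _).trans h)]
      have h3 : oscInt F w w = 0 := intervalIntegral.integral_same
      rw [h1, h2, h3, add_zero]
    · have h1 : clampTo u w x = w := by rw [clampTo, min_eq_left h, max_eq_right huw]
      have h2 : clampTo u v x = clampTo w v x := by
        rw [clampTo, clampTo, max_eq_right (le_min hwv h), max_eq_right (le_min (huw.trans hwv)
          (huw.trans h))]
      rw [h1, h2, oscInt_add]
  have hsub : ∀ s x y, oscInt F x y = oscInt F s y - oscInt F s x := by
    intro s x y; rw [← oscInt_add F s x y]; ring
  rw [hsub u (clampTo u v a), hsub u (clampTo u w a), hsub w (clampTo w v a), key a, key b]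
  ring

lemma arcSquareSum_split (k : ℕ) (S : Finset ℕ) (F : Polynomial ℝ) {u w v : ℝ} (huw : u ≤ w)
    (hwv : w ≤ v) :
    arcSquareSum k S F u v ≤ 2 * arcSquareSum k S F u w + 2 * arcSquareSum k S F w v := by
  unfold arcSquareSum
  rw [Finset.mul_sum, Finset.mul_sum, ← Finset.sum_add_distrib]
  refine Finset.sum_le_sum fun i _ => ?_
  rw [oscInt_clampTo_split F huw hwv]
  set x := oscInt F (clampTo u w ((i : ℝ) / 2 ^ k)) (clampTo u w ((i + 1) / 2 ^ k))
  set y := oscInt F (clampTo w v ((i : ℝ) / 2 ^ k)) (clampTo w v ((i + 1) / 2 ^ k))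
  have h2 : (2 : ℝ≥0∞) = ENNReal.ofReal 2 := by norm_num
  rw [h2, ← ENNReal.ofReal_mul (by norm_num), ← ENNReal.ofReal_mul (by norm_num),
    ← ENNReal.ofReal_add (by positivity) (by positivity)]
  apply ENNReal.ofReal_le_ofReal
  have := norm_add_le x y
  nlinarith [sq_nonneg (‖x‖ - ‖y‖), norm_nonneg (x + y), norm_nonneg x, norm_nonneg y]

lemma Polynomial.sign_of_forall_ne {G : Polynomial ℝ} {u v : ℝ} (huv : u ≤ v)
    (h : ∀ t ∈ Set.Ioo u v, G.eval t ≠ 0) :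
    u = v ∨ (∀ t ∈ Set.Icc u v, 0 ≤ G.eval t) ∨ (∀ t ∈ Set.Icc u v, G.eval t ≤ 0) := by
  rcases huv.eq_or_lt with huv' | huv'
  · exact Or.inl huv'
  right
  have hpre : IsPreconnected ((fun t => G.eval t) '' Set.Ioo u v) :=
    isPreconnected_Ioo.image _ G.continuous.continuousOn
  have hside : (∀ t ∈ Set.Ioo u v, 0 ≤ G.eval t) ∨ (∀ t ∈ Set.Ioo u v, G.eval t ≤ 0) := by
    by_contra! hcon
    obtain ⟨⟨s, hs, hs'⟩, t, ht, ht'⟩ := hcon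
    obtain ⟨z, hz, hz'⟩ := hpre.ordConnected.out ⟨s, hs, rfl⟩ ⟨t, ht, rfl⟩ ⟨hs'.le, ht'.le⟩
    exact h z hz hz'
  rw [← closure_Ioo huv'.ne]
  refine hside.imp (fun h1 => ?_) (fun h1 => ?_)
  · exact (isClosed_le continuous_const G.continuous).closure_subset_iff.2 h1
  · exact (isClosed_le G.continuous continuous_const).closure_subset_iff.2 h1

/-- Pointwise bound for the square function, by splitting at the zeros of `F''`. -/
lemma arcSquareSum_le {k : ℕ} {S : Finset ℕ} {m : ℕ → ℕ}
    (hm : ∀ r ≤ k, ∀ j, (S.filter (· / 2 ^ (k - r) = j)).card ≤ m r) (hm1 : ∀ r, k < r → 1 ≤ m r)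
    (F : Polynomial ℝ) :
    arcSquareSum k S F 0 1 ≤ 4 ^ F.natDegree * (720 * slowMajorant k S m F) := by
  classical
  set R := F.derivative.derivative.roots.toFinset with hR
  have hpiece : ∀ u v, 0 ≤ u → u ≤ v → v ≤ 1 →
      (∀ t ∈ Set.Ioo u v, F.derivative.derivative.eval t ≠ 0) →
      arcSquareSum k S F u v ≤ 720 * slowMajorant k S m F := by
    intro u v hu huv hv hne
    rcases Polynomial.sign_of_forall_ne huv hne with h | h | h
    · subst h
      have h0 : ∀ x, clampTo u u x = u := fun x =>
        le_antisymm (clampTo_le le_rfl x) (le_clampTo u u x)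
      simp [arcSquareSum, h0, oscInt]
    · exact arcSquareSum_le_of_nonneg hm hm1 F hu huv hv h
    · rw [← arcSquareSum_neg, ← slowMajorant_neg]
      refine arcSquareSum_le_of_nonneg hm hm1 (-F) hu huv hv fun t ht => ?_
      have := h t ht
      simpa using this
  by_cases hF : F.derivative.derivative = 0
  · calc _ ≤ 720 * slowMajorant k S m F :=
          arcSquareSum_le_of_nonneg hm hm1 F le_rfl zero_le_one le_rfl (by simp [hF])
      _ ≤ _ := le_mul_of_one_le_left zero_le (one_le_pow₀ (by norm_num))
  have hind : ∀ N : ℕ, ∀ u v, 0 ≤ u → u ≤ v → v ≤ 1 →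
      (R.filter fun t => t ∈ Set.Ioo u v).card ≤ N →
      arcSquareSum k S F u v ≤ 4 ^ N * (720 * slowMajorant k S m F) := by
    intro N
    induction N with
    | zero =>
      intro u v hu huv hv hcard
      rw [pow_zero, one_mul]
      refine hpiece u v hu huv hv fun t ht h0 => ?_
      have : t ∈ R.filter fun t => t ∈ Set.Ioo u v := by
        rw [Finset.mem_filter, hR, Multiset.mem_toFinset, Polynomial.mem_roots hF]
        exact ⟨h0, ht⟩
      rw [Nat.le_zero, Finset.card_eq_zero] at hcard
      rw [hcard] at this
      simp at this
    | succ N ih =>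
      intro u v hu huv hv hcard
      rcases (R.filter fun t => t ∈ Set.Ioo u v).eq_empty_or_nonempty with he | ⟨w, hw⟩
      · refine (ih u v hu huv hv (by rw [he]; simp)).trans ?_
        gcongr
        · norm_num
        · omega
      have hw' := Finset.mem_filter.1 hw
      have hlt : ∀ T : Finset ℝ, T ⊆ (R.filter fun t => t ∈ Set.Ioo u v) → w ∉ T → T.card ≤ N := by
        intro T hT hwT
        have : T.card < (R.filter fun t => t ∈ Set.Ioo u v).card :=
          Finset.card_lt_card ⟨hT, fun h => hwT (h hw)⟩
        omega
      have h1 := ih u w hu hw'.2.1.le (hw'.2.2.le.trans hv) (hlt _ (fun t ht => by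
        rw [Finset.mem_filter] at ht ⊢
        exact ⟨ht.1, ht.2.1, ht.2.2.trans hw'.2.2⟩) (by simp))
      have h2 := ih w v (hu.trans hw'.2.1.le) hw'.2.2.le hv (hlt _ (fun t ht => by
        rw [Finset.mem_filter] at ht ⊢
        exact ⟨ht.1, hw'.2.1.trans ht.2.1, ht.2.2⟩) (by simp))
      calc _ ≤ 2 * arcSquareSum k S F u w + 2 * arcSquareSum k S F w v :=
            arcSquareSum_split k S F hw'.2.1.le hw'.2.2.le
        _ ≤ 2 * (4 ^ N * (720 * slowMajorant k S m F)) +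
            2 * (4 ^ N * (720 * slowMajorant k S m F)) := by gcongr
        _ = _ := by rw [pow_succ]; ring
  apply hind _ 0 1 le_rfl zero_le_one le_rfl
  calc _ ≤ R.card := Finset.card_filter_le _ _
    _ ≤ F.derivative.derivative.roots.card := Multiset.toFinset_card_le _
    _ ≤ F.derivative.derivative.natDegree := Polynomial.card_roots' _
    _ ≤ F.natDegree := by
        have h1 := Polynomial.natDegree_derivative_le F
        have h2 := Polynomial.natDegree_derivative_le F.derivative
        omega

/-! ### Volume of the slow sets -/

/-- The phase `t ↦ ⟨ξ, (t, t², …, t^d)⟩` as a polynomial in `t`. -/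
noncomputable def momentPhase {d : ℕ} (ξ : EuclideanSpace ℝ (Fin d)) : Polynomial ℝ :=
  ∑ i : Fin d, Polynomial.C (ξ i) * Polynomial.X ^ ((i : ℕ) + 1)

lemma momentPhase_eval {d : ℕ} (ξ : EuclideanSpace ℝ (Fin d)) (t : ℝ) :
    (momentPhase ξ).eval t = ∑ i : Fin d, ξ i * t ^ ((i : ℕ) + 1) := by
  simp [momentPhase, Polynomial.eval_finsetSum]

lemma momentPhase_natDegree_le {d : ℕ} (ξ : EuclideanSpace ℝ (Fin d)) :
    (momentPhase ξ).natDegree ≤ d := by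
  refine Polynomial.natDegree_sum_le_of_forall_le _ _ fun i _ => ?_
  exact (Polynomial.natDegree_C_mul_X_pow_le _ _).trans i.2

lemma momentPhase_derivative_eval {d : ℕ} (ξ : EuclideanSpace ℝ (Fin d)) (t : ℝ) :
    (momentPhase ξ).derivative.eval t = ∑ i : Fin d, ξ i * (((i : ℕ) + 1) * t ^ (i : ℕ)) := by
  simp [momentPhase, Polynomial.eval_finsetSum]

/-- Taking the nodes `x` inside an interval, the values of the derivative of the phase at the nodes
depend linearly on `ξ`, through a Vandermonde matrix. -/
lemma volume_abs_derivative_le {d : ℕ} (x : Fin d → ℝ) {δ lam : ℝ} (hδ : 0 < δ) (hlam : 0 ≤ lam)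
    (hx : ∀ i j, i < j → δ ≤ x j - x i) :
    volume {ξ : EuclideanSpace ℝ (Fin d) | ∀ k, |(momentPhase ξ).derivative.eval (x k)| ≤ lam} ≤
      ENNReal.ofReal (δ⁻¹ ^ (d * (d - 1) / 2) * (2 * lam) ^ d) := by
  set M : Matrix (Fin d) (Fin d) ℝ :=
    Matrix.vandermonde x * Matrix.diagonal fun i : Fin d => ((i : ℕ) : ℝ) + 1 with hM
  have hMul : ∀ ξ : Fin d → ℝ, ∀ k, Matrix.toLin' M ξ k =
      ∑ i : Fin d, ξ i * (((i : ℕ) + 1) * x k ^ (i : ℕ)) := by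
    intro ξ k
    rw [Matrix.toLin'_apply, Matrix.mulVec, dotProduct]
    refine Finset.sum_congr rfl fun i _ => ?_
    rw [hM, Matrix.mul_diagonal, Matrix.vandermonde_apply]
    ring
  have hdet : δ ^ (d * (d - 1) / 2) ≤ M.det := by
    rw [hM, Matrix.det_mul, Matrix.det_vandermonde, Matrix.det_diagonal]
    have hexp : d * (d - 1) / 2 = ∑ i : Fin d, (Finset.Ioi i).card := by
      simp only [Fin.card_Ioi]
      rw [Fin.sum_univ_eq_sum_range (fun i => d - 1 - i) d, Finset.sum_range_reflect (fun i => i) d,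
        Finset.sum_range_id]
    have h1 : δ ^ (d * (d - 1) / 2) ≤ ∏ i : Fin d, ∏ j ∈ Finset.Ioi i, (x j - x i) := by
      rw [hexp, ← Finset.prod_pow_eq_pow_sum]
      refine Finset.prod_le_prod (fun i _ => by positivity) fun i _ => ?_
      rw [← Finset.prod_const]
      exact Finset.prod_le_prod (fun i _ => hδ.le) fun j hj => hx i j (Finset.mem_Ioi.1 hj)
    have h2 : (1 : ℝ) ≤ ∏ i : Fin d, (((i : ℕ) : ℝ) + 1) := by
      rw [← Finset.prod_const_one (s := (Finset.univ : Finset (Fin d)))]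
      exact Finset.prod_le_prod (fun _ _ => zero_le_one) fun i _ => by simp
    have h0 : 0 ≤ δ ^ (d * (d - 1) / 2) := by positivity
    nlinarith
  have hdet0 : 0 < M.det := lt_of_lt_of_le (by positivity) hdet
  have hset : {ξ : EuclideanSpace ℝ (Fin d) |
      ∀ k, |(momentPhase ξ).derivative.eval (x k)| ≤ lam} =
      (WithLp.ofLp : EuclideanSpace ℝ (Fin d) → (Fin d → ℝ)) ⁻¹' (Matrix.toLin' M ⁻¹'
        (Set.Icc (fun _ => -lam) fun _ => lam)) := by
    ext ξ
    simp only [Set.mem_preimage, Set.mem_Icc, Set.mem_ofPred_eq, Pi.le_def, hMul, abs_le,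
      momentPhase_derivative_eval, forall_and]
  have hdetlin : LinearMap.det (Matrix.toLin' M) = M.det := LinearMap.det_toLin' M
  have hmeas : MeasurableSet (Matrix.toLin' M ⁻¹' (Set.Icc (fun _ => -lam) fun _ => lam)) :=
    (LinearMap.continuous_of_finiteDimensional _).measurable measurableSet_Icc
  rw [hset, (PiLp.volume_preserving_ofLp (Fin d)).measure_preimage hmeas.nullMeasurableSet,
    Measure.addHaar_preimage_linearMap _ (by rw [hdetlin]; exact hdet0.ne'), hdetlin,
    Real.volume_Icc_pi]
  simp only [Finset.prod_const, Finset.card_univ, Fintype.card_fin]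
  rw [← ENNReal.ofReal_pow (by linarith), ← ENNReal.ofReal_mul (by positivity)]
  apply ENNReal.ofReal_le_ofReal
  rw [abs_of_pos (inv_pos.2 hdet0), show lam - -lam = 2 * lam by ring, inv_pow]
  gcongr

lemma volume_slow_le {d : ℕ} (a : ℝ) (n r : ℕ) :
    volume {ξ : EuclideanSpace ℝ (Fin d) | ∀ t ∈ Set.Ioo (a / 2 ^ r) ((a + 1) / 2 ^ r),
      |(momentPhase ξ).derivative.eval t| ≤ 2 ^ n} ≤
    ENNReal.ofReal ((((d : ℝ) + 1) * 2 ^ r) ^ (d * (d - 1) / 2) * (2 * 2 ^ n) ^ d) := by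
  have h2r : (0 : ℝ) < 2 ^ r := by positivity
  have hd : (0 : ℝ) < (d : ℝ) + 1 := by positivity
  set x : Fin d → ℝ := fun k => (a + (((k : ℕ) : ℝ) + 1) / (d + 1)) / 2 ^ r with hx
  have hxd : ∀ i j, i < j → (((d : ℝ) + 1) * 2 ^ r)⁻¹ ≤ x j - x i := by
    intro i j hij
    have h1 : ((i : ℕ) : ℝ) + 1 ≤ (j : ℕ) := by exact_mod_cast hij
    have h2 : x j - x i = (((j : ℕ) : ℝ) - (i : ℕ)) * (((d : ℝ) + 1) * 2 ^ r)⁻¹ := by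
      simp only [hx]; field_simp; ring
    rw [h2]
    exact le_mul_of_one_le_left (by positivity) (by linarith)
  have := volume_abs_derivative_le x (lam := 2 ^ n) (by positivity) (by positivity) hxd
  rw [inv_inv] at this
  refine (measure_mono fun ξ hξ => ?_).trans this
  refine Set.mem_ofPred_eq ▸ fun k => hξ (x k) ?_
  have hk : ((k : ℕ) : ℝ) + 1 < d + 1 := by
    have : ((k : ℕ) : ℝ) < d := by exact_mod_cast k.2
    linarith
  constructor
  · simp only [hx]
    gcongr
    have : (0 : ℝ) < (((k : ℕ) : ℝ) + 1) / (d + 1) := by positivity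
    linarith
  · simp only [hx]
    gcongr
    rw [div_lt_one hd]; exact hk

lemma slowNear_momentPhase_eq {d : ℕ} (k : ℕ) (S : Finset ℕ) (n r : ℕ) :
    {ξ : EuclideanSpace ℝ (Fin d) | SlowNear k S n r (momentPhase ξ)} =
      ⋃ j ∈ dyadicLevel k S r, ⋃ c ∈ Finset.range 11, {ξ | ∀ t ∈ Set.Ioo (((j : ℝ) + c - 5) / 2 ^ r)
        (((j : ℝ) + c - 4) / 2 ^ r), |(momentPhase ξ).derivative.eval t| ≤ 2 ^ n} := by
  ext ξ
  simp [SlowNear]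

lemma volume_slowNear_le {d : ℕ} (k : ℕ) (S : Finset ℕ) (n r : ℕ) :
    volume {ξ : EuclideanSpace ℝ (Fin d) | SlowNear k S n r (momentPhase ξ)} ≤
    ENNReal.ofReal ((dyadicLevel k S r).card * (11 *
      ((((d : ℝ) + 1) * 2 ^ r) ^ (d * (d - 1) / 2) * (2 * 2 ^ n) ^ d))) := by
  set V := (((d : ℝ) + 1) * 2 ^ r) ^ (d * (d - 1) / 2) * (2 * 2 ^ n) ^ d with hV
  have hV0 : 0 ≤ V := by positivity
  rw [slowNear_momentPhase_eq]
  calc _ ≤ ∑ j ∈ dyadicLevel k S r, ∑ c ∈ Finset.range 11, ENNReal.ofReal V := by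
        refine (measure_biUnion_finset_le _ _).trans (Finset.sum_le_sum fun j _ => ?_)
        refine (measure_biUnion_finset_le _ _).trans (Finset.sum_le_sum fun c _ => ?_)
        have := volume_slow_le (d := d) ((j : ℝ) + c - 5) n r
        rwa [show (j : ℝ) + c - 5 + 1 = j + c - 4 by ring] at this
    _ = _ := by
        rw [Finset.sum_const, Finset.sum_const, nsmul_eq_mul, nsmul_eq_mul, Finset.card_range,
          ENNReal.ofReal_mul (p := ((dyadicLevel k S r).card : ℝ)) (by positivity),
          ENNReal.ofReal_mul (p := 11) (by positivity)]
        simp only [ENNReal.ofReal_natCast, ENNReal.ofReal_ofNat, Nat.cast_ofNat]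

lemma continuous_momentPhase_derivative_eval {d : ℕ} (t : ℝ) :
    Continuous fun ξ : EuclideanSpace ℝ (Fin d) => (momentPhase ξ).derivative.eval t := by
  simp only [momentPhase_derivative_eval]
  fun_prop

lemma measurableSet_slowNear {d : ℕ} (k : ℕ) (S : Finset ℕ) (n r : ℕ) :
    MeasurableSet {ξ : EuclideanSpace ℝ (Fin d) | SlowNear k S n r (momentPhase ξ)} := by
  rw [slowNear_momentPhase_eq]
  refine Finset.measurableSet_biUnion _ fun j _ => Finset.measurableSet_biUnion _ fun c _ => ?_
  apply IsClosed.measurableSet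
  simp only [Set.ofPred_forall]
  exact isClosed_iInter fun t => isClosed_iInter fun _ =>
    isClosed_le (continuous_momentPhase_derivative_eval t).abs continuous_const

/-! ### Minkowski's inequality and regular families of dyadic intervals -/

/-- Minkowski's inequality for finite sums. -/
lemma lintegral_Lp_finsetSum_le {X ι : Type*} [MeasurableSpace X] {μ : Measure X} {q : ℝ}
    (hq : 1 ≤ q) (s : Finset ι) (f : ι → X → ℝ≥0∞) (hf : ∀ i, Measurable (f i)) :
    (∫⁻ x, (∑ i ∈ s, f i x) ^ q ∂μ) ^ (1 / q) ≤ ∑ i ∈ s, (∫⁻ x, f i x ^ q ∂μ) ^ (1 / q) := by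
  classical
  induction s using Finset.induction_on with
  | empty => simp [ENNReal.zero_rpow_of_pos (zero_lt_one.trans_le hq), (zero_lt_one.trans_le hq)]
  | insert a s ha ih =>
    simp only [Finset.sum_insert ha]
    refine (ENNReal.lintegral_Lp_add_le (hf a).aemeasurable
      (Finset.measurable_sum s fun i _ => hf i).aemeasurable hq).trans ?_
    gcongr

/-- Minkowski's inequality for countable sums. -/
lemma lintegral_Lp_tsum_le {X : Type*} [MeasurableSpace X] {μ : Measure X} {q : ℝ}
    (hq : 1 ≤ q) (f : ℕ → X → ℝ≥0∞) (hf : ∀ i, Measurable (f i)) :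
    (∫⁻ x, (∑' i, f i x) ^ q ∂μ) ^ (1 / q) ≤ ∑' i, (∫⁻ x, f i x ^ q ∂μ) ^ (1 / q) := by
  have hq0 : 0 < q := zero_lt_one.trans_le hq
  rw [one_div, ENNReal.rpow_inv_le_iff hq0]
  have hmono : ∀ x, Monotone fun n => (∑ i ∈ Finset.range n, f i x) ^ q := fun x a b hab =>
    ENNReal.rpow_le_rpow (Finset.sum_le_sum_of_subset (Finset.range_mono hab)) hq0.le
  have h1 : ∀ x, (∑' i, f i x) ^ q = ⨆ n, (∑ i ∈ Finset.range n, f i x) ^ q := by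
    intro x
    rw [ENNReal.tsum_eq_iSup_nat]
    exact (ENNReal.orderIsoRpow q hq0).map_iSup _
  simp only [h1]
  rw [lintegral_iSup (fun n => (Finset.measurable_sum _ fun i _ => hf i).pow_const q)
    fun a b hab x => hmono x hab]
  refine iSup_le fun n => ?_
  rw [← ENNReal.rpow_inv_le_iff hq0, ← one_div]
  refine (lintegral_Lp_finsetSum_le hq _ f hf).trans ?_
  simp only [one_div]
  exact ENNReal.sum_le_tsum _

/-- The regularity of a finite union of dyadic intervals `[i / 2ᵏ, (i + 1) / 2ᵏ]`, `i ∈ S`, at the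
scales `2⁻ʳ`, `r ≤ k`: it lies in at most `2 ^ e r` dyadic intervals of length `2⁻ʳ`, each of which
contains at most `2 ^ (e k - e r)` of the intervals. -/
structure DyadicRegular (e : ℕ → ℕ) (k : ℕ) (S : Finset ℕ) : Prop where
  lt : ∀ i ∈ S, i < 2 ^ k
  card_eq : S.card = 2 ^ e k
  card_ancestors : ∀ r ≤ k, (S.image (· / 2 ^ (k - r))).card ≤ 2 ^ e r
  card_fiber : ∀ r ≤ k, ∀ j, (S.filter (· / 2 ^ (k - r) = j)).card ≤ 2 ^ (e k - e r)

/-- The bound that `DyadicRegular` gives for the number of intervals of length `2⁻ᵏ` in one of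
length `2⁻ʳ`. -/
def fiberBound (e : ℕ → ℕ) (k r : ℕ) : ℕ := 2 ^ (e k - e (min r k))

lemma DyadicRegular.arcSquareSum_le {e : ℕ → ℕ} {k : ℕ} {S : Finset ℕ} (h : DyadicRegular e k S)
    (F : Polynomial ℝ) :
    arcSquareSum k S F 0 1 ≤ 4 ^ F.natDegree * (720 * slowMajorant k S (fiberBound e k) F) := by
  refine _root_.arcSquareSum_le (fun r hr j => ?_) (fun r _ => Nat.one_le_two_pow) F
  simpa only [fiberBound, min_eq_left hr] using h.card_fiber r hr j

lemma DyadicRegular.card_level_le {e : ℕ → ℕ} {k : ℕ} {S : Finset ℕ} (h : DyadicRegular e k S)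
    (r : ℕ) : (dyadicLevel k S r).card ≤ 2 ^ (e (min r k)) * 2 ^ (r - k) := by
  rcases le_or_gt r k with hr | hr
  · rw [dyadicLevel, if_pos hr, min_eq_left hr, Nat.sub_eq_zero_of_le hr, pow_zero, mul_one]
    exact h.card_ancestors r hr
  · rw [dyadicLevel, if_neg (not_le.2 hr), min_eq_right hr.le, ← h.card_eq]
    refine Finset.card_biUnion_le_card_mul _ _ _ fun i _ => ?_
    rw [Nat.card_Ico, ← Nat.sub_mul]
    simp

/-- The three ways in which the exponent condition is used: at unit scale, at the scale of the
arcs, and inside a single arc. -/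
lemma scale_exponent_le {α p θ E d : ℝ} (hE : 0 ≤ E)
    (h1 : θ ≤ α * p / 2 - d) (h2 : θ ≤ α * p - α - (E + d)) (h3 : θ ≤ p - 1 - (E + d))
    {n k r : ℝ} (hk : 0 ≤ k) (hkn : k ≤ n) (hr : 0 ≤ r) (hrn : r ≤ n) :
    -(n - k) * p - α * p * k + (α * k - α * min r k) * (p / 2) + α * min r k + (r - min r k)
      + r * E + n * d ≤ -θ * n := by
  have hnk : 0 ≤ n - k := by linarith
  rcases le_total r k with hrk | hrk
  · rw [min_eq_left hrk]
    rcases le_total (α + E - α * p / 2) 0 with hB | hB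
    · have e1 := mul_le_mul_of_nonneg_left h1 hk
      have e3 := mul_le_mul_of_nonneg_left h3 hnk
      have e4 := mul_nonpos_of_nonpos_of_nonneg hB hr
      nlinarith
    · have e1 := mul_le_mul_of_nonneg_left h2 hk
      have e3 := mul_le_mul_of_nonneg_left h3 hnk
      have e4 := mul_le_mul_of_nonneg_left hrk hB
      nlinarith
  · rw [min_eq_right hrk]
    have e1 := mul_le_mul_of_nonneg_left h2 hk
    have e3 := mul_le_mul_of_nonneg_left h3 hnk
    have e4 := mul_le_mul_of_nonneg_left hrn (show 0 ≤ 1 + E by linarith)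
    nlinarith

/-! ### `L^{p/2}` bound for the majorant -/

/-- The contribution of the scales `2⁻ⁿ` and `2⁻ʳ` to the `L^{p/2}` norm of the majorant. -/
lemma scale_term_le {α p θ : ℝ} {d : ℕ} (hp : 0 < p)
    (h1 : θ ≤ α * p / 2 - d) (h2 : θ ≤ α * p - α - (((d * (d - 1) / 2 : ℕ) : ℝ) + d))
    (h3 : θ ≤ p - 1 - (((d * (d - 1) / 2 : ℕ) : ℝ) + d))
    {e : ℕ → ℕ} (he : Monotone e) (hle : ∀ r, (e r : ℝ) ≤ α * r) (hge : ∀ r, α * r - 1 ≤ e r)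
    {k n r : ℕ} (hkn : k ≤ n) (hrn : r ≤ n) :
    ((4 : ℝ) ^ k / (2 ^ e k) ^ 2 * (4⁻¹) ^ n * fiberBound e k r) ^ (p / 2) *
      ((2 ^ (e (min r k)) * 2 ^ (r - k)) * (11 *
      ((((d : ℝ) + 1) * 2 ^ r) ^ (d * (d - 1) / 2) * (2 * 2 ^ n) ^ d))) ≤
    2 ^ p * (11 * ((d : ℝ) + 1) ^ (d * (d - 1) / 2) * 2 ^ d) * (2 : ℝ) ^ (-θ * n) := by
  set E := d * (d - 1) / 2 with hE
  set s := min r k with hs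
  have hes : e s ≤ e k := he (min_le_right _ _)
  have two0 : (0 : ℝ) < 2 := two_pos
  have hrk : ((r - k : ℕ) : ℝ) = r - s := by
    rcases le_total r k with h | h
    · rw [Nat.sub_eq_zero_of_le h, hs, min_eq_left h]; simp
    · rw [Nat.cast_sub h, hs, min_eq_right h]
  have hw : (4 : ℝ) ^ k / (2 ^ e k) ^ 2 * (4⁻¹) ^ n * fiberBound e k r =
      (2 : ℝ) ^ (-2 * ((n : ℝ) - k) - e k - e s) := by
    have h4 : (4 : ℝ) = 2 ^ (2 : ℝ) := by norm_num
    rw [fiberBound]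
    push_cast
    rw [← hs, h4, inv_pow]
    simp only [← Real.rpow_natCast, ← Real.rpow_mul two0.le]
    rw [← Real.rpow_sub two0, ← Real.rpow_neg two0.le, ← Real.rpow_add two0, ← Real.rpow_add two0,
      Nat.cast_sub hes]
    congr 1
    push_cast
    ring
  have hV : (2 ^ (e s) * 2 ^ (r - k)) * (11 *
      ((((d : ℝ) + 1) * 2 ^ r) ^ E * (2 * 2 ^ n) ^ d)) =
      (11 * ((d : ℝ) + 1) ^ E * 2 ^ d) * (2 : ℝ) ^ ((e s : ℝ) + (r - s) + r * E + n * d) := by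
    rw [Real.rpow_add two0, Real.rpow_add two0, Real.rpow_add two0, Real.rpow_mul two0.le,
      Real.rpow_mul two0.le, ← hrk]
    simp only [Real.rpow_natCast]
    rw [mul_pow, mul_pow]
    ring
  rw [hw, hV, ← Real.rpow_mul two0.le]
  have key := scale_exponent_le (α := α) (p := p) (E := (E : ℝ)) (d := d) (θ := θ) (by positivity)
    h1 h2 h3 (n := n) (k := k) (r := r) (by positivity) (by exact_mod_cast hkn) (by positivity)
    (by exact_mod_cast hrn)
  have hsc : min (r : ℝ) k = s := by rw [hs]; push_cast; rfl
  rw [hsc] at key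
  have hexp : (-2 * ((n : ℝ) - k) - e k - e s) * (p / 2) +
      ((e s : ℝ) + (r - s) + r * E + n * d) ≤ p + -θ * n := by
    have a1 := hge k
    have a2 := hge s
    have a3 := hle s
    have a4 : ((α * k - 1) + (α * s - 1)) * (p / 2) ≤ ((e k : ℝ) + e s) * (p / 2) := by
      gcongr
    nlinarith
  calc _ = (11 * ((d : ℝ) + 1) ^ E * 2 ^ d) *
        (2 : ℝ) ^ ((-2 * ((n : ℝ) - k) - e k - e s) * (p / 2) +
          ((e s : ℝ) + (r - s) + r * E + n * d)) := by
        rw [Real.rpow_add two0 ((-2 * ((n : ℝ) - k) - e k - e s) * (p / 2))]; ring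
    _ ≤ (11 * ((d : ℝ) + 1) ^ E * 2 ^ d) * (2 : ℝ) ^ (p + -θ * n) := by
        gcongr
        norm_num
    _ = _ := by rw [Real.rpow_add two0]; ring

lemma exists_sum_geometric_le {σ : ℝ} (hσ0 : 0 < σ) (hσ1 : σ < 1) :
    ∃ M : ℝ, 0 < M ∧ ∀ k : ℕ,
      ∑' l : ℕ, ENNReal.ofReal (((k + l : ℕ) + 1) * (σ ^ 2) ^ (k + l)) ≤
        ENNReal.ofReal (M * σ ^ k) := by
  have ht : Filter.Tendsto (fun n : ℕ => ((n : ℝ) + 1) * σ ^ n) Filter.atTop (nhds 0) := by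
    have h1 := tendsto_self_mul_const_pow_of_lt_one hσ0.le hσ1
    have h2 := tendsto_pow_atTop_nhds_zero_of_lt_one hσ0.le hσ1
    simpa [add_mul] using h1.add h2
  obtain ⟨M, hM⟩ := ht.bddAbove_range
  have hM' : ∀ n : ℕ, ((n : ℝ) + 1) * σ ^ n ≤ M := fun n => hM ⟨n, rfl⟩
  have hM1 : 0 < M := by have := hM' 0; simp at this; linarith
  have h1σ : 0 < 1 - σ := by linarith
  refine ⟨M * (1 - σ)⁻¹, by positivity, fun k => ?_⟩
  have hsum : HasSum (fun l : ℕ => M * σ ^ k * σ ^ l) (M * σ ^ k * (1 - σ)⁻¹) :=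
    (hasSum_geometric_of_lt_one hσ0.le hσ1).mul_left _
  calc _ ≤ ∑' l : ℕ, ENNReal.ofReal (M * σ ^ k * σ ^ l) := by
        refine ENNReal.tsum_le_tsum fun l => ENNReal.ofReal_le_ofReal ?_
        have := hM' (k + l)
        have h0 : 0 ≤ σ ^ (k + l) := by positivity
        calc ((k + l : ℕ) + 1) * (σ ^ 2) ^ (k + l)
            = (((k + l : ℕ) : ℝ) + 1) * σ ^ (k + l) * σ ^ (k + l) := by
              rw [← pow_mul, mul_comm 2, pow_mul, sq]; ring
          _ ≤ M * σ ^ (k + l) := by gcongr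
          _ = _ := by rw [pow_add]; ring
    _ = ENNReal.ofReal (M * σ ^ k * (1 - σ)⁻¹) := by
        rw [← hsum.tsum_eq, ENNReal.ofReal_tsum_of_nonneg (fun l => by positivity) hsum.summable]
    _ = _ := by congr 1; ring

/-- The normalized majorant decays geometrically in `L^{p/2}`. -/
theorem exists_lintegral_slowMajorant_le {α p : ℝ} {d : ℕ} (hp : 2 ≤ p)
    (h1 : (d : ℝ) < α * p / 2) (h2 : ((d * (d - 1) / 2 : ℕ) : ℝ) + d < α * p - α)
    (h3 : ((d * (d - 1) / 2 : ℕ) : ℝ) + d < p - 1)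
    {e : ℕ → ℕ} (he : Monotone e) (hle : ∀ r, (e r : ℝ) ≤ α * r) (hge : ∀ r, α * r - 1 ≤ e r) :
    ∃ C σ : ℝ, 0 < C ∧ 0 < σ ∧ σ < 1 ∧ ∀ k S, DyadicRegular e k S →
      (∫⁻ ξ : EuclideanSpace ℝ (Fin d), (ENNReal.ofReal (4 ^ k / (2 ^ e k) ^ 2) *
        slowMajorant k S (fiberBound e k) (momentPhase ξ)) ^ (p / 2)) ^ (1 / (p / 2)) ≤
        ENNReal.ofReal (C * σ ^ k) := by
  set E := d * (d - 1) / 2 with hE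
  set q := p / 2 with hq
  have hq1 : 1 ≤ q := by rw [hq]; linarith
  have hq0 : 0 < q := by linarith
  obtain ⟨θ, hθ0, hθ1, hθ2, hθ3⟩ : ∃ θ : ℝ, 0 < θ ∧ θ ≤ α * p / 2 - d ∧
      θ ≤ α * p - α - ((E : ℝ) + d) ∧ θ ≤ p - 1 - ((E : ℝ) + d) :=
    ⟨min (α * p / 2 - d) (min (α * p - α - ((E : ℝ) + d)) (p - 1 - ((E : ℝ) + d))),
      lt_min (by linarith) (lt_min (by linarith) (by linarith)), min_le_left _ _,
      (min_le_right _ _).trans (min_le_left _ _), (min_le_right _ _).trans (min_le_right _ _)⟩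
  set C0 : ℝ := 2 ^ p * (11 * ((d : ℝ) + 1) ^ E * 2 ^ d) with hC0
  have hC0p : 0 < C0 := by positivity
  set σ : ℝ := 2 ^ (-θ / (2 * q)) with hσ
  have hσ0 : 0 < σ := by positivity
  have hσ1 : σ < 1 := Real.rpow_lt_one_of_one_lt_of_neg one_lt_two
    (div_neg_of_neg_of_pos (by linarith) (by linarith))
  obtain ⟨M, hM, hMk⟩ := exists_sum_geometric_le hσ0 hσ1
  refine ⟨C0 ^ (1 / q) * M, σ, by positivity, hσ0, hσ1, fun k S hS => ?_⟩
  set c : ℝ := 4 ^ k / (2 ^ e k) ^ 2 with hc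
  have hc0 : 0 ≤ c := by positivity
  let A : ℕ → ℕ → Set (EuclideanSpace ℝ (Fin d)) := fun n r =>
    {ξ | SlowNear k S n r (momentPhase ξ)}
  let w : ℕ → ℕ → ℝ := fun n r => c * 4⁻¹ ^ n * fiberBound e k r
  have hw0 : ∀ n r, 0 ≤ w n r := fun n r => by positivity
  let f : ℕ → ℕ → EuclideanSpace ℝ (Fin d) → ℝ≥0∞ := fun n r =>
    (A n r).indicator fun _ => ENNReal.ofReal (w n r)
  have hf : ∀ n r, Measurable (f n r) := fun n r =>
    measurable_const.indicator (measurableSet_slowNear k S n r)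
  have hexpand : ∀ ξ, ENNReal.ofReal c * slowMajorant k S (fiberBound e k) (momentPhase ξ) =
      ∑' l : ℕ, ∑ r ∈ Finset.range (k + l + 1), f (k + l) r ξ := by
    intro ξ
    rw [slowMajorant, ← ENNReal.tsum_mul_left]
    refine tsum_congr fun l => ?_
    rw [Finset.mul_sum]
    refine Finset.sum_congr rfl fun r _ => ?_
    by_cases hs : SlowNear k S (k + l) r (momentPhase ξ)
    · rw [Set.indicator_of_mem (by exact hs)]
      simp only [f]
      rw [Set.indicator_of_mem (by exact hs)]
      simp only [w]
      rw [ENNReal.ofReal_mul (by positivity), ENNReal.ofReal_mul hc0,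
        ENNReal.ofReal_pow (by norm_num), ENNReal.ofReal_inv_of_pos (by norm_num)]
      simp [mul_assoc]
    · rw [Set.indicator_of_notMem (by exact hs)]
      simp only [f]
      rw [Set.indicator_of_notMem (by exact hs)]
      simp
  have hterm : ∀ n r, k ≤ n → r ≤ n →
      (∫⁻ ξ, f n r ξ ^ q) ^ (1 / q) ≤ ENNReal.ofReal (C0 ^ (1 / q) * (σ ^ 2) ^ n) := by
    intro n r hkn hrn
    have hint : ∫⁻ ξ, f n r ξ ^ q = ENNReal.ofReal (w n r ^ q) * volume (A n r) := by
      have : ∀ ξ, f n r ξ ^ q = (A n r).indicator (fun _ => ENNReal.ofReal (w n r ^ q)) ξ := by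
        intro ξ
        simp only [f]
        by_cases hξ : ξ ∈ A n r
        · rw [Set.indicator_of_mem hξ, Set.indicator_of_mem hξ,
            ENNReal.ofReal_rpow_of_nonneg (hw0 n r) hq0.le]
        · rw [Set.indicator_of_notMem hξ, Set.indicator_of_notMem hξ, ENNReal.zero_rpow_of_pos hq0]
      simp only [this]
      rw [lintegral_indicator_const (measurableSet_slowNear k S n r)]
    have hbound : ∫⁻ ξ, f n r ξ ^ q ≤ ENNReal.ofReal (C0 * 2 ^ (-θ * n)) := by
      rw [hint]
      calc _ ≤ ENNReal.ofReal (w n r ^ q) * ENNReal.ofReal ((dyadicLevel k S r).card * (11 *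
              ((((d : ℝ) + 1) * 2 ^ r) ^ (d * (d - 1) / 2) * (2 * 2 ^ n) ^ d))) := by
            gcongr
            exact volume_slowNear_le k S n r
        _ = ENNReal.ofReal (w n r ^ q * ((dyadicLevel k S r).card * (11 *
              ((((d : ℝ) + 1) * 2 ^ r) ^ (d * (d - 1) / 2) * (2 * 2 ^ n) ^ d)))) := by
            rw [ENNReal.ofReal_mul (Real.rpow_nonneg (hw0 n r) _)]
        _ ≤ _ := by
            apply ENNReal.ofReal_le_ofReal
            refine le_trans ?_ (scale_term_le (by linarith) hθ1 hθ2 hθ3 he hle hge hkn hrn)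
            have := hS.card_level_le r
            have hcard : ((dyadicLevel k S r).card : ℝ) ≤ 2 ^ (e (min r k)) * 2 ^ (r - k) := by
              exact_mod_cast this
            have := Real.rpow_nonneg (hw0 n r) q
            gcongr
    calc _ ≤ ENNReal.ofReal (C0 * 2 ^ (-θ * n)) ^ (1 / q) := by gcongr
      _ = ENNReal.ofReal ((C0 * 2 ^ (-θ * n)) ^ (1 / q)) :=
          ENNReal.ofReal_rpow_of_nonneg (by positivity) (by positivity)
      _ = _ := by
          congr 1
          rw [Real.mul_rpow hC0p.le (by positivity), hσ, ← Real.rpow_mul two_pos.le,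
            ← Real.rpow_natCast, ← Real.rpow_natCast, ← Real.rpow_mul two_pos.le,
            ← Real.rpow_mul two_pos.le]
          congr 2
          push_cast
          field_simp
  calc _ = (∫⁻ ξ, (∑' l : ℕ, ∑ r ∈ Finset.range (k + l + 1), f (k + l) r ξ) ^ q) ^ (1 / q) := by
        simp only [hexpand]
    _ ≤ ∑' l : ℕ, (∫⁻ ξ, (∑ r ∈ Finset.range (k + l + 1), f (k + l) r ξ) ^ q) ^ (1 / q) :=
        lintegral_Lp_tsum_le hq1 _ fun l => Finset.measurable_sum _ fun r _ => hf _ r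
    _ ≤ ∑' l : ℕ, ∑ r ∈ Finset.range (k + l + 1), (∫⁻ ξ, f (k + l) r ξ ^ q) ^ (1 / q) :=
        ENNReal.tsum_le_tsum fun l => lintegral_Lp_finsetSum_le hq1 _ _ fun r => hf _ r
    _ ≤ ∑' l : ℕ, ∑ r ∈ Finset.range (k + l + 1),
          ENNReal.ofReal (C0 ^ (1 / q) * (σ ^ 2) ^ (k + l)) :=
        ENNReal.tsum_le_tsum fun l => Finset.sum_le_sum fun r hr =>
          hterm _ r (by omega) (by have := Finset.mem_range.1 hr; omega)
    _ = ENNReal.ofReal (C0 ^ (1 / q)) *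
          ∑' l : ℕ, ENNReal.ofReal (((k + l : ℕ) + 1) * (σ ^ 2) ^ (k + l)) := by
        rw [← ENNReal.tsum_mul_left]
        refine tsum_congr fun l => ?_
        rw [Finset.sum_const, Finset.card_range, nsmul_eq_mul,
          ← ENNReal.ofReal_mul (by positivity), ← ENNReal.ofReal_natCast,
          ← ENNReal.ofReal_mul (by positivity)]
        congr 1
        push_cast
        ring
    _ ≤ ENNReal.ofReal (C0 ^ (1 / q)) * ENNReal.ofReal (M * σ ^ k) := by
        gcongr
        exact hMk k
    _ = _ := by rw [← ENNReal.ofReal_mul (by positivity)]; congr 1; ring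

/-! ### Khintchine's inequality -/

lemma sum_powerset_exp_le (S : Finset ℕ) (a : ℕ → ℝ) :
    ∑ T ∈ S.powerset, Real.exp (∑ i ∈ S, if i ∈ T then a i else -a i) ≤
      2 ^ S.card * Real.exp ((∑ i ∈ S, a i ^ 2) / 2) := by
  have h1 : ∀ T ∈ S.powerset, Real.exp (∑ i ∈ S, if i ∈ T then a i else -a i) =
      (∏ i ∈ T, Real.exp (a i)) * ∏ i ∈ S \ T, Real.exp (-a i) := by
    intro T hT
    rw [Finset.mem_powerset] at hT
    rw [Real.exp_sum, ← Finset.prod_sdiff hT, mul_comm]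
    congr 1
    · exact Finset.prod_congr rfl fun i hi => by rw [if_pos hi]
    · exact Finset.prod_congr rfl fun i hi => by rw [if_neg (Finset.mem_sdiff.1 hi).2]
  rw [Finset.sum_congr rfl h1, ← Finset.prod_add, Finset.sum_div, Real.exp_sum,
    ← Finset.prod_const, ← Finset.prod_mul_distrib]
  refine Finset.prod_le_prod (fun i _ => by positivity) fun i _ => ?_
  have := Real.cosh_le_exp_half_sq (a i)
  rw [Real.cosh_eq] at this
  linarith

/-- This follows from `|x| / p ≤ exp (|x| / p)`. -/
lemma rpow_abs_le_exp {p : ℝ} (hp : 0 < p) (x : ℝ) :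
    |x| ^ p ≤ p ^ p * (Real.exp x + Real.exp (-x)) := by
  have h1 : |x| ^ p ≤ p ^ p * Real.exp |x| := by
    calc |x| ^ p = p ^ p * (|x| / p) ^ p := by
          rw [← Real.mul_rpow hp.le (by positivity), mul_div_cancel₀ _ hp.ne']
      _ ≤ p ^ p * (Real.exp (|x| / p)) ^ p := by
          gcongr
          linarith [Real.add_one_le_exp (|x| / p)]
      _ = _ := by rw [← Real.exp_mul, div_mul_cancel₀ _ hp.ne']
  refine h1.trans ?_
  gcongr
  rcases abs_cases x with ⟨h, _⟩ | ⟨h, _⟩ <;> rw [h] <;>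
    linarith [Real.exp_pos x, Real.exp_pos (-x)]

lemma khintchine_real {p : ℝ} (hp : 0 < p) (S : Finset ℕ) (a : ℕ → ℝ) :
    ∑ T ∈ S.powerset, |∑ i ∈ S, if i ∈ T then a i else -a i| ^ p ≤
      p ^ p * (2 * Real.exp (1 / 2)) * 2 ^ S.card * (∑ i ∈ S, a i ^ 2) ^ (p / 2) := by
  set Q := ∑ i ∈ S, a i ^ 2 with hQ
  have hQ0 : 0 ≤ Q := Finset.sum_nonneg fun i _ => sq_nonneg _
  rcases hQ0.eq_or_lt with h0 | hpos
  · have ha : ∀ i ∈ S, a i = 0 := by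
      intro i hi
      have := (Finset.sum_eq_zero_iff_of_nonneg fun i _ => sq_nonneg (a i)).1 h0.symm i hi
      exact pow_eq_zero_iff two_ne_zero |>.1 this
    have : ∀ T ∈ S.powerset, |∑ i ∈ S, if i ∈ T then a i else -a i| ^ p = 0 := by
      intro T _
      rw [Finset.sum_eq_zero fun i hi => by simp [ha i hi], abs_zero, Real.zero_rpow hp.ne']
    rw [Finset.sum_eq_zero this]
    positivity
  -- normalize so that the sum of the squares is `1`
  set s := Real.sqrt Q with hs
  have hs0 : 0 < s := Real.sqrt_pos.2 hpos
  have hs2 : s ^ 2 = Q := Real.sq_sqrt hQ0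
  set b : ℕ → ℝ := fun i => a i / s with hb
  have hbQ : ∑ i ∈ S, b i ^ 2 = 1 := by
    simp only [hb, div_pow]
    rw [← Finset.sum_div, hs2, ← hQ, div_self hpos.ne']
  have hab : ∀ T : Finset ℕ, ∑ i ∈ S, (if i ∈ T then a i else -a i) =
      s * ∑ i ∈ S, if i ∈ T then b i else -b i := by
    intro T
    rw [Finset.mul_sum]
    refine Finset.sum_congr rfl fun i _ => ?_
    split_ifs
    · simp only [hb]; field_simp
    · simp only [hb]; field_simp
  have hsp : s ^ p = Q ^ (p / 2) := by
    rw [hs, Real.sqrt_eq_rpow, ← Real.rpow_mul hQ0]; congr 1; ring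
  have e1 := sum_powerset_exp_le S b
  have e2 := sum_powerset_exp_le S fun i => -b i
  simp only [neg_sq] at e2
  rw [hbQ] at e1 e2
  calc _ = ∑ T ∈ S.powerset, s ^ p * |∑ i ∈ S, if i ∈ T then b i else -b i| ^ p := by
        refine Finset.sum_congr rfl fun T _ => ?_
        rw [hab, abs_mul, abs_of_pos hs0, Real.mul_rpow hs0.le (abs_nonneg _)]
    _ ≤ ∑ T ∈ S.powerset, s ^ p * (p ^ p * (Real.exp (∑ i ∈ S, if i ∈ T then b i else -b i) +
          Real.exp (∑ i ∈ S, if i ∈ T then -b i else - -b i))) := by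
        refine Finset.sum_le_sum fun T _ => ?_
        gcongr
        have hneg : ∑ i ∈ S, (if i ∈ T then -b i else - -b i) =
            -∑ i ∈ S, if i ∈ T then b i else -b i := by
          rw [← Finset.sum_neg_distrib]
          refine Finset.sum_congr rfl fun i _ => ?_
          split_ifs <;> rfl
        rw [hneg]
        exact rpow_abs_le_exp hp _
    _ ≤ s ^ p * (p ^ p * (2 ^ S.card * Real.exp (1 / 2) + 2 ^ S.card * Real.exp (1 / 2))) := by
        rw [← Finset.mul_sum, ← Finset.mul_sum, Finset.sum_add_distrib]
        gcongr
    _ = _ := by rw [hsp]; ring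

/-- Khintchine's inequality, for sums over all choices of signs. -/
lemma khintchine {p : ℝ} (hp : 0 < p) : ∃ K : ℝ, 0 < K ∧ ∀ (S : Finset ℕ) (z : ℕ → ℂ),
    ∑ T ∈ S.powerset, ‖∑ i ∈ S, if i ∈ T then z i else -z i‖ ^ p ≤
      K * 2 ^ S.card * (∑ i ∈ S, ‖z i‖ ^ 2) ^ (p / 2) := by
  set K0 := p ^ p * (2 * Real.exp (1 / 2)) with hK0
  have hK0p : 0 < K0 := by positivity
  refine ⟨2 ^ p * (K0 + K0), by positivity, fun S z => ?_⟩
  have hre := khintchine_real hp S fun i => (z i).re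
  have him := khintchine_real hp S fun i => (z i).im
  have hreQ : (∑ i ∈ S, (z i).re ^ 2) ^ (p / 2) ≤ (∑ i ∈ S, ‖z i‖ ^ 2) ^ (p / 2) := by
    refine Real.rpow_le_rpow (Finset.sum_nonneg fun i _ => sq_nonneg _)
      (Finset.sum_le_sum fun i _ => ?_) (by positivity)
    rw [sq_le_sq, abs_of_nonneg (norm_nonneg (z i))]
    exact Complex.abs_re_le_norm _
  have himQ : (∑ i ∈ S, (z i).im ^ 2) ^ (p / 2) ≤ (∑ i ∈ S, ‖z i‖ ^ 2) ^ (p / 2) := by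
    refine Real.rpow_le_rpow (Finset.sum_nonneg fun i _ => sq_nonneg _)
      (Finset.sum_le_sum fun i _ => ?_) (by positivity)
    rw [sq_le_sq, abs_of_nonneg (norm_nonneg (z i))]
    exact Complex.abs_im_le_norm _
  have hmain : ∀ T : Finset ℕ, ‖∑ i ∈ S, if i ∈ T then z i else -z i‖ ^ p ≤
      2 ^ p * (|∑ i ∈ S, if i ∈ T then (z i).re else -(z i).re| ^ p +
        |∑ i ∈ S, if i ∈ T then (z i).im else -(z i).im| ^ p) := by
    intro T
    set w := ∑ i ∈ S, if i ∈ T then z i else -z i with hw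
    have h1 : w.re = ∑ i ∈ S, if i ∈ T then (z i).re else -(z i).re := by
      rw [hw, Complex.re_sum]
      refine Finset.sum_congr rfl fun i _ => ?_
      split_ifs <;> simp
    have h2 : w.im = ∑ i ∈ S, if i ∈ T then (z i).im else -(z i).im := by
      rw [hw, Complex.im_sum]
      refine Finset.sum_congr rfl fun i _ => ?_
      split_ifs <;> simp
    rw [← h1, ← h2]
    have h3 : ‖w‖ ≤ 2 * max |w.re| |w.im| := by
      have := Complex.norm_le_abs_re_add_abs_im w
      linarith [le_max_left |w.re| |w.im|, le_max_right |w.re| |w.im|]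
    calc ‖w‖ ^ p ≤ (2 * max |w.re| |w.im|) ^ p := by gcongr
      _ = 2 ^ p * (max |w.re| |w.im|) ^ p := Real.mul_rpow (by norm_num) (by positivity)
      _ ≤ _ := by
          gcongr
          rcases max_cases |w.re| |w.im| with ⟨h, _⟩ | ⟨h, _⟩ <;> rw [h] <;>
            linarith [Real.rpow_nonneg (abs_nonneg w.re) p, Real.rpow_nonneg (abs_nonneg w.im) p]
  calc _ ≤ ∑ T ∈ S.powerset, 2 ^ p * (|∑ i ∈ S, if i ∈ T then (z i).re else -(z i).re| ^ p +
        |∑ i ∈ S, if i ∈ T then (z i).im else -(z i).im| ^ p) :=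
        Finset.sum_le_sum fun T _ => hmain T
    _ ≤ 2 ^ p * (K0 * 2 ^ S.card * (∑ i ∈ S, (z i).re ^ 2) ^ (p / 2) +
          K0 * 2 ^ S.card * (∑ i ∈ S, (z i).im ^ 2) ^ (p / 2)) := by
        rw [← Finset.mul_sum, Finset.sum_add_distrib]
        gcongr
    _ ≤ 2 ^ p * (K0 * 2 ^ S.card * (∑ i ∈ S, ‖z i‖ ^ 2) ^ (p / 2) +
          K0 * 2 ^ S.card * (∑ i ∈ S, ‖z i‖ ^ 2) ^ (p / 2)) := by gcongr
    _ = _ := by ring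

/-- Some choice of signs is at least as good, in `L^p`, as the square function. -/
lemma exists_signs {X : Type*} [MeasurableSpace X] (μ : Measure X) {p : ℝ} (hp : 0 < p) :
    ∃ K : ℝ, 0 < K ∧ ∀ (S : Finset ℕ) (z : ℕ → X → ℂ), (∀ i, Measurable (z i)) →
      ∃ T ⊆ S, ∫⁻ x, ENNReal.ofReal (‖∑ i ∈ S, if i ∈ T then z i x else -z i x‖ ^ p) ∂μ ≤
        ENNReal.ofReal K * ∫⁻ x, ENNReal.ofReal ((∑ i ∈ S, ‖z i x‖ ^ 2) ^ (p / 2)) ∂μ := by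
  obtain ⟨K, hK, hkh⟩ := khintchine hp
  refine ⟨K, hK, fun S z hz => ?_⟩
  set Φ : Finset ℕ → ℝ≥0∞ := fun T =>
    ∫⁻ x, ENNReal.ofReal (‖∑ i ∈ S, if i ∈ T then z i x else -z i x‖ ^ p) ∂μ with hΦ
  obtain ⟨T, hT, hmin⟩ := Finset.exists_min_image S.powerset Φ ⟨∅, by simp⟩
  refine ⟨T, Finset.mem_powerset.1 hT, ?_⟩
  have hmeas : ∀ T : Finset ℕ, Measurable fun x =>
      ENNReal.ofReal (‖∑ i ∈ S, if i ∈ T then z i x else -z i x‖ ^ p) := by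
    intro T
    refine ENNReal.measurable_ofReal.comp (Measurable.pow_const ?_ p)
    refine Measurable.norm (Finset.measurable_sum S fun i _ => ?_)
    split_ifs
    · exact hz i
    · exact (hz i).neg
  have h2 : (2 : ℝ≥0∞) ^ S.card * Φ T ≤ (2 : ℝ≥0∞) ^ S.card *
      (ENNReal.ofReal K * ∫⁻ x, ENNReal.ofReal ((∑ i ∈ S, ‖z i x‖ ^ 2) ^ (p / 2)) ∂μ) := by
    calc (2 : ℝ≥0∞) ^ S.card * Φ T = ∑ _T' ∈ S.powerset, Φ T := by
          rw [Finset.sum_const, Finset.card_powerset, nsmul_eq_mul]; push_cast; rfl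
      _ ≤ ∑ T' ∈ S.powerset, Φ T' := Finset.sum_le_sum hmin
      _ = ∫⁻ x, ENNReal.ofReal (∑ T' ∈ S.powerset,
            ‖∑ i ∈ S, if i ∈ T' then z i x else -z i x‖ ^ p) ∂μ := by
          rw [hΦ, ← lintegral_finsetSum _ fun T _ => hmeas T]
          congr 1
          ext x
          rw [ENNReal.ofReal_sum_of_nonneg fun _ _ => by positivity]
      _ ≤ ∫⁻ x, ENNReal.ofReal (2 ^ S.card * K) *
            ENNReal.ofReal ((∑ i ∈ S, ‖z i x‖ ^ 2) ^ (p / 2)) ∂μ := by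
          refine lintegral_mono fun x => ?_
          rw [← ENNReal.ofReal_mul (by positivity)]
          apply ENNReal.ofReal_le_ofReal
          have := hkh S fun i => z i x
          rwa [mul_comm K] at this
      _ = _ := by
          rw [lintegral_const_mul' _ _ ENNReal.ofReal_ne_top, ENNReal.ofReal_mul (by positivity),
            ENNReal.ofReal_pow (by norm_num), ENNReal.ofReal_ofNat, mul_assoc]
  exact (ENNReal.mul_le_mul_iff_right (by positivity) (by finiteness)).1 h2

/-! ### Arcs of the moment curve and their Fourier transforms -/

/-- The Fourier transform of the uniform probability measure on the arc of the moment curve over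
`[i / 2ᵏ, (i + 1) / 2ᵏ]` (with the sign `+` in the exponential). -/
noncomputable def arcTransform {d : ℕ} (k i : ℕ) (ξ : EuclideanSpace ℝ (Fin d)) : ℂ :=
  2 ^ k * oscInt (momentPhase ξ) ((i : ℝ) / 2 ^ k) ((i + 1) / 2 ^ k)

/-- The Fourier transform of the average of the uniform measures on the arcs indexed by `S`, when
`S` has `2 ^ e k` elements. -/
noncomputable def cantorTransform {d : ℕ} (e : ℕ → ℕ) (k : ℕ) (S : Finset ℕ)
    (ξ : EuclideanSpace ℝ (Fin d)) : ℂ :=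
  (2 ^ e k)⁻¹ * ∑ i ∈ S, arcTransform k i ξ

lemma continuous_arcTransform {d : ℕ} (k i : ℕ) :
    Continuous fun ξ : EuclideanSpace ℝ (Fin d) => arcTransform k i ξ := by
  unfold arcTransform oscInt
  refine continuous_const.mul ?_
  apply intervalIntegral.continuous_parametric_intervalIntegral_of_continuous'
  simp only [Function.uncurry_def, momentPhase_eval]
  fun_prop

lemma continuous_cantorTransform {d : ℕ} (e : ℕ → ℕ) (k : ℕ) (S : Finset ℕ) :
    Continuous fun ξ : EuclideanSpace ℝ (Fin d) => cantorTransform e k S ξ :=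
  continuous_const.mul (continuous_finsetSum _ fun i _ => continuous_arcTransform k i)

lemma arcTransform_eq_children {d : ℕ} (k i : ℕ) (ξ : EuclideanSpace ℝ (Fin d)) :
    arcTransform k i ξ = (arcTransform (k + 1) (2 * i) ξ + arcTransform (k + 1) (2 * i + 1) ξ) / 2 := by
  unfold arcTransform
  have h1 : (((2 * i : ℕ) : ℝ)) / 2 ^ (k + 1) = i / 2 ^ k := by
    rw [pow_succ]; push_cast; field_simp
  have h2 : (((2 * i + 1 : ℕ) : ℝ) + 1) / 2 ^ (k + 1) = (i + 1) / 2 ^ k := by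
    rw [pow_succ]; push_cast; field_simp; ring
  have h3 : (((2 * i : ℕ) : ℝ) + 1) / 2 ^ (k + 1) = ((2 * i + 1 : ℕ) : ℝ) / 2 ^ (k + 1) := by
    push_cast; rfl
  rw [h3, h1, h2, ← oscInt_add (momentPhase ξ) (i / 2 ^ k) (((2 * i + 1 : ℕ) : ℝ) / 2 ^ (k + 1))]
  rw [pow_succ]
  ring

lemma norm_arcTransform_le {d : ℕ} (k i : ℕ) (ξ : EuclideanSpace ℝ (Fin d)) :
    ‖arcTransform k i ξ‖ ≤ 1 := by
  rw [arcTransform, norm_mul, norm_pow, Complex.norm_ofNat]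
  have h := norm_oscInt_le (momentPhase ξ) (dyadic_le k i)
  rw [dyadic_sub] at h
  calc (2 : ℝ) ^ k * _ ≤ 2 ^ k * (1 / 2 ^ k) := by gcongr
    _ = 1 := by field_simp

lemma norm_cantorTransform_le {d : ℕ} {e : ℕ → ℕ} {k : ℕ} {S : Finset ℕ}
    (h : DyadicRegular e k S) (ξ : EuclideanSpace ℝ (Fin d)) : ‖cantorTransform e k S ξ‖ ≤ 1 := by
  rw [cantorTransform, norm_mul, norm_inv, norm_pow, Complex.norm_ofNat]
  have h1 : ‖∑ i ∈ S, arcTransform k i ξ‖ ≤ 2 ^ e k := by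
    refine (norm_sum_le_of_le S fun i _ => norm_arcTransform_le k i ξ).trans ?_
    rw [Finset.sum_const, h.card_eq]; simp
  calc _ ≤ ((2 : ℝ) ^ e k)⁻¹ * 2 ^ e k := by gcongr
    _ = 1 := by field_simp

lemma ofReal_sum_arcTransform {d k : ℕ} {e : ℕ → ℕ} {S : Finset ℕ} (h : DyadicRegular e k S)
    (ξ : EuclideanSpace ℝ (Fin d)) :
    ENNReal.ofReal (((2 ^ e k)⁻¹) ^ 2 * ∑ i ∈ S, ‖arcTransform k i ξ‖ ^ 2) =
      ENNReal.ofReal (4 ^ k / (2 ^ e k) ^ 2) * arcSquareSum k S (momentPhase ξ) 0 1 := by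
  have hclamp : ∀ i ∈ S, clampTo 0 1 ((i : ℝ) / 2 ^ k) = i / 2 ^ k ∧
      clampTo 0 1 (((i : ℝ) + 1) / 2 ^ k) = (i + 1) / 2 ^ k := by
    intro i hi
    have h1 : ((i : ℝ) + 1) ≤ 2 ^ k := by exact_mod_cast h.lt i hi
    have h2 : ((i : ℝ) + 1) / 2 ^ k ≤ 1 := by rw [div_le_one (by positivity)]; exact h1
    have h3 := dyadic_le k i
    unfold clampTo
    rw [min_eq_right (h3.trans h2), min_eq_right h2]
    exact ⟨max_eq_right (by positivity), max_eq_right (by positivity)⟩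
  rw [arcSquareSum, ← ENNReal.ofReal_sum_of_nonneg fun _ _ => by positivity,
    ← ENNReal.ofReal_mul (by positivity)]
  congr 1
  rw [Finset.mul_sum, Finset.mul_sum]
  refine Finset.sum_congr rfl fun i hi => ?_
  rw [(hclamp i hi).1, (hclamp i hi).2, arcTransform, norm_mul, norm_pow, Complex.norm_ofNat,
    mul_pow, ← pow_mul, mul_comm k 2, pow_mul]
  norm_num
  ring

/-- The normalized square function of a regular family of arcs decays geometrically in `L^p`. -/
theorem exists_lintegral_squareFunction_le {α p : ℝ} {d : ℕ} (hp : 2 ≤ p)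
    (h1 : (d : ℝ) < α * p / 2) (h2 : ((d * (d - 1) / 2 : ℕ) : ℝ) + d < α * p - α)
    (h3 : ((d * (d - 1) / 2 : ℕ) : ℝ) + d < p - 1)
    {e : ℕ → ℕ} (he : Monotone e) (hle : ∀ r, (e r : ℝ) ≤ α * r) (hge : ∀ r, α * r - 1 ≤ e r) :
    ∃ C σ : ℝ, 0 < C ∧ 0 < σ ∧ σ < 1 ∧ ∀ k S, DyadicRegular e k S →
      ∫⁻ ξ : EuclideanSpace ℝ (Fin d), ENNReal.ofReal
        ((((2 ^ e k)⁻¹) ^ 2 * ∑ i ∈ S, ‖arcTransform k i ξ‖ ^ 2) ^ (p / 2)) ≤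
        ENNReal.ofReal (C * σ ^ k) := by
  obtain ⟨C, σ, hC, hσ0, hσ1, hbd⟩ := exists_lintegral_slowMajorant_le hp h1 h2 h3 he hle hge
  set q := p / 2 with hq
  have hq0 : 0 < q := by rw [hq]; linarith
  refine ⟨(4 ^ d * 720 * C) ^ q, σ ^ q, by positivity, by positivity,
    Real.rpow_lt_one hσ0.le hσ1 hq0, fun k S hS => ?_⟩
  have h := hbd k S hS
  rw [one_div, ENNReal.rpow_inv_le_iff hq0] at h
  have hpt : ∀ ξ : EuclideanSpace ℝ (Fin d), ENNReal.ofReal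
      ((((2 ^ e k)⁻¹) ^ 2 * ∑ i ∈ S, ‖arcTransform k i ξ‖ ^ 2) ^ q) ≤
      (4 ^ d * 720 : ℝ≥0∞) ^ q * (ENNReal.ofReal (4 ^ k / (2 ^ e k) ^ 2) *
        slowMajorant k S (fiberBound e k) (momentPhase ξ)) ^ q := by
    intro ξ
    rw [← ENNReal.ofReal_rpow_of_nonneg (by positivity) hq0.le, ofReal_sum_arcTransform hS,
      ← ENNReal.mul_rpow_of_nonneg _ _ hq0.le]
    refine ENNReal.rpow_le_rpow ?_ hq0.le
    calc _ ≤ ENNReal.ofReal (4 ^ k / (2 ^ e k) ^ 2) * (4 ^ (momentPhase ξ).natDegree *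
          (720 * slowMajorant k S (fiberBound e k) (momentPhase ξ))) := by
          gcongr
          exact hS.arcSquareSum_le _
      _ ≤ ENNReal.ofReal (4 ^ k / (2 ^ e k) ^ 2) * (4 ^ d *
          (720 * slowMajorant k S (fiberBound e k) (momentPhase ξ))) := by
          gcongr
          · norm_num
          · exact momentPhase_natDegree_le ξ
      _ = _ := by ring
  calc _ ≤ ∫⁻ ξ : EuclideanSpace ℝ (Fin d), (4 ^ d * 720 : ℝ≥0∞) ^ q *
        (ENNReal.ofReal (4 ^ k / (2 ^ e k) ^ 2) *
          slowMajorant k S (fiberBound e k) (momentPhase ξ)) ^ q := lintegral_mono hpt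
    _ ≤ (4 ^ d * 720 : ℝ≥0∞) ^ q * ENNReal.ofReal (C * σ ^ k) ^ q := by
        rw [lintegral_const_mul' _ _ (by finiteness)]
        gcongr
    _ = ENNReal.ofReal ((4 ^ d * 720 * C) ^ q * (σ ^ q) ^ k) := by
        rw [← ENNReal.mul_rpow_of_nonneg _ _ hq0.le]
        have : (4 ^ d * 720 : ℝ≥0∞) = ENNReal.ofReal (4 ^ d * 720) := by
          rw [ENNReal.ofReal_mul (by positivity), ENNReal.ofReal_pow (by norm_num)]; norm_num
        rw [this, ← ENNReal.ofReal_mul (by positivity),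
          ENNReal.ofReal_rpow_of_nonneg (by positivity) hq0.le]
        congr 1
        rw [← mul_assoc, Real.mul_rpow (by positivity) (by positivity), ← Real.rpow_natCast σ k,
          ← Real.rpow_natCast (σ ^ q) k, ← Real.rpow_mul hσ0.le, ← Real.rpow_mul hσ0.le,
          mul_comm (k : ℝ) q]

lemma DyadicRegular.zero {e : ℕ → ℕ} (he : e 0 = 0) : DyadicRegular e 0 {0} where
  lt := by simp
  card_eq := by simp [he]
  card_ancestors := by
    intro r hr
    obtain rfl : r = 0 := by omega
    simp [he]
  card_fiber := by
    intro r hr j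
    obtain rfl : r = 0 := by omega
    exact (Finset.card_filter_le _ _).trans (by simp)

/-- Regularity is inherited when every interval keeps at most `2 ^ (e (k + 1) - e k)` of its two
children and the total count is right. -/
lemma DyadicRegular.succ {e : ℕ → ℕ} {k : ℕ} {S S' : Finset ℕ} (he : Monotone e)
    (h : DyadicRegular e k S) (hpar : ∀ i ∈ S', i / 2 ∈ S)
    (hchild : ∀ i, (S'.filter (· / 2 = i)).card ≤ 2 ^ (e (k + 1) - e k))
    (hcard : S'.card = 2 ^ e (k + 1)) : DyadicRegular e (k + 1) S' where
  lt := by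
    intro i hi
    have := h.lt _ (hpar i hi)
    rw [pow_succ]; omega
  card_eq := hcard
  card_ancestors := by
    intro r hr
    rcases hr.eq_or_lt with rfl | hr
    · rw [← hcard]; exact Finset.card_image_le
    · refine (Finset.card_le_card ?_).trans (h.card_ancestors r (by omega))
      intro a ha
      obtain ⟨i, hi, rfl⟩ := Finset.mem_image.1 ha
      refine Finset.mem_image.2 ⟨i / 2, hpar i hi, ?_⟩
      rw [Nat.div_div_eq_div_mul, ← pow_succ']
      congr 2; omega
  card_fiber := by
    intro r hr j
    rcases hr.eq_or_lt with rfl | hr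
    · rw [Nat.sub_self, Nat.sub_self, pow_zero]
      refine Finset.card_le_one.2 fun a ha b hb => ?_
      simp only [Nat.div_one, Finset.mem_filter] at ha hb
      rw [ha.2, hb.2]
    · have hrk : r ≤ k := by omega
      have h1 := he hrk
      have h2 := he (Nat.le_succ k)
      calc _ ≤ ((S.filter (· / 2 ^ (k - r) = j)).biUnion fun i => S'.filter (· / 2 = i)).card := by
            refine Finset.card_le_card fun i hi => ?_
            rw [Finset.mem_filter] at hi
            refine Finset.mem_biUnion.2 ⟨i / 2, Finset.mem_filter.2 ⟨hpar i hi.1, ?_⟩,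
              Finset.mem_filter.2 ⟨hi.1, rfl⟩⟩
            rw [← hi.2, Nat.div_div_eq_div_mul, ← pow_succ']
            congr 2; omega
        _ ≤ (S.filter (· / 2 ^ (k - r) = j)).card * 2 ^ (e (k + 1) - e k) :=
            Finset.card_biUnion_le_card_mul _ _ _ fun i _ => hchild i
        _ ≤ 2 ^ (e k - e r) * 2 ^ (e (k + 1) - e k) := by
            gcongr
            exact h.card_fiber r hrk j
        _ = _ := by rw [← pow_add]; congr 1; simp only [Nat.succ_eq_add_one] at h2; omega

lemma two_mul_add_injective {s : ℕ → ℕ} (hs : ∀ i, s i ≤ 1) :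
    Function.Injective fun i => 2 * i + s i := by
  intro a b hab
  have h1 := hs a
  have h2 := hs b
  simp only at hab
  omega

/-- Keeping one child of each interval. -/
lemma DyadicRegular.choose {e : ℕ → ℕ} {k : ℕ} {S : Finset ℕ} (he : Monotone e)
    (h : DyadicRegular e k S) (hek : e (k + 1) = e k) {s : ℕ → ℕ} (hs : ∀ i, s i ≤ 1) :
    DyadicRegular e (k + 1) (S.image fun i => 2 * i + s i) := by
  have hdiv : ∀ i, (2 * i + s i) / 2 = i := fun i => by have := hs i; omega
  refine h.succ he ?_ ?_ ?_
  · intro i hi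
    obtain ⟨a, ha, rfl⟩ := Finset.mem_image.1 hi
    rwa [hdiv]
  · intro i
    rw [hek, Nat.sub_self, pow_zero]
    refine Finset.card_le_one.2 fun a ha b hb => ?_
    rw [Finset.mem_filter] at ha hb
    obtain ⟨a', ha', rfl⟩ := Finset.mem_image.1 ha.1
    obtain ⟨b', hb', rfl⟩ := Finset.mem_image.1 hb.1
    have e1 := ha.2
    have e2 := hb.2
    rw [hdiv] at e1 e2
    rw [e1, e2]
  · rw [Finset.card_image_of_injective _ (two_mul_add_injective hs), h.card_eq, hek]

lemma disjoint_children (S : Finset ℕ) :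
    Disjoint (S.image fun i => 2 * i) (S.image fun i => 2 * i + 1) := by
  rw [Finset.disjoint_left]
  intro a ha hb
  obtain ⟨x, _, rfl⟩ := Finset.mem_image.1 ha
  obtain ⟨y, _, hy⟩ := Finset.mem_image.1 hb
  omega

/-- Keeping both children of each interval. -/
lemma DyadicRegular.split {e : ℕ → ℕ} {k : ℕ} {S : Finset ℕ} (he : Monotone e)
    (h : DyadicRegular e k S) (hek : e (k + 1) = e k + 1) :
    DyadicRegular e (k + 1) ((S.image fun i => 2 * i) ∪ S.image fun i => 2 * i + 1) := by
  refine h.succ he ?_ ?_ ?_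
  · intro i hi
    rcases Finset.mem_union.1 hi with hi | hi <;> obtain ⟨a, ha, rfl⟩ := Finset.mem_image.1 hi
    · rwa [show 2 * a / 2 = a by omega]
    · rwa [show (2 * a + 1) / 2 = a by omega]
  · intro i
    rw [hek, show e k + 1 - e k = 1 by omega, pow_one]
    refine (Finset.card_le_card (t := {2 * i, 2 * i + 1}) fun a ha => ?_).trans Finset.card_le_two
    have := (Finset.mem_filter.1 ha).2
    rw [Finset.mem_insert, Finset.mem_singleton]
    omega
  · rw [Finset.card_union_of_disjoint (disjoint_children S),
      Finset.card_image_of_injective _ fun a b hab => by simpa using hab,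
      Finset.card_image_of_injective _ fun a b hab => by simpa using hab, h.card_eq, hek, pow_succ]
    ring

/-! ### Construction of the Cantor set -/

lemma cantorTransform_split {d : ℕ} {e : ℕ → ℕ} {k : ℕ} (S : Finset ℕ)
    (hek : e (k + 1) = e k + 1) (ξ : EuclideanSpace ℝ (Fin d)) :
    cantorTransform e (k + 1) ((S.image fun i => 2 * i) ∪ S.image fun i => 2 * i + 1) ξ =
      cantorTransform e k S ξ := by
  rw [cantorTransform, cantorTransform, Finset.sum_union (disjoint_children S),
    Finset.sum_image fun a _ b _ hab => by simpa using hab,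
    Finset.sum_image fun a _ b _ hab => by simpa using hab, ← Finset.sum_add_distrib, hek,
    Finset.mul_sum, Finset.mul_sum]
  refine Finset.sum_congr rfl fun i _ => ?_
  rw [arcTransform_eq_children k i, pow_succ]
  ring

/-- Half the difference of the transforms of the two halves of an arc, normalized. -/
noncomputable def haarTransform {d : ℕ} (e : ℕ → ℕ) (k i : ℕ) (ξ : EuclideanSpace ℝ (Fin d)) : ℂ :=
  (2 ^ e k)⁻¹ * ((arcTransform (k + 1) (2 * i) ξ - arcTransform (k + 1) (2 * i + 1) ξ) / 2)

/-- A choice of children changes the transform by a signed sum. -/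
lemma cantorTransform_choose {d : ℕ} {e : ℕ → ℕ} {k : ℕ} (S T : Finset ℕ)
    (hek : e (k + 1) = e k) (ξ : EuclideanSpace ℝ (Fin d)) :
    cantorTransform e (k + 1) (S.image fun i => 2 * i + if i ∈ T then 0 else 1) ξ -
      cantorTransform e k S ξ =
      ∑ i ∈ S, if i ∈ T then haarTransform e k i ξ else -haarTransform e k i ξ := by
  have hinj := two_mul_add_injective (s := fun i => if i ∈ T then 0 else 1)
    fun i => by split_ifs <;> omega
  rw [cantorTransform, cantorTransform, Finset.sum_image hinj.injOn, hek, Finset.mul_sum,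
    Finset.mul_sum, ← Finset.sum_sub_distrib]
  refine Finset.sum_congr rfl fun i _ => ?_
  rw [arcTransform_eq_children k i, haarTransform]
  split_ifs
  · rw [add_zero]; ring
  · ring

lemma sum_haarTransform_le {d : ℕ} {e : ℕ → ℕ} {k : ℕ} (S : Finset ℕ) (hek : e (k + 1) = e k)
    (ξ : EuclideanSpace ℝ (Fin d)) :
    ∑ i ∈ S, ‖haarTransform e k i ξ‖ ^ 2 ≤
      ((2 ^ e (k + 1))⁻¹) ^ 2 * ∑ i ∈ S.image (fun i => 2 * i + 0), ‖arcTransform (k + 1) i ξ‖ ^ 2 +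
      ((2 ^ e (k + 1))⁻¹) ^ 2 * ∑ i ∈ S.image (fun i => 2 * i + 1),
        ‖arcTransform (k + 1) i ξ‖ ^ 2 := by
  rw [Finset.sum_image fun a _ b _ hab => by simpa using hab,
    Finset.sum_image fun a _ b _ hab => by simpa using hab, hek, ← mul_add,
    ← Finset.sum_add_distrib, Finset.mul_sum]
  refine Finset.sum_le_sum fun i _ => ?_
  rw [haarTransform, norm_mul, mul_pow, norm_inv, norm_pow, Complex.norm_ofNat, norm_div,
    Complex.norm_ofNat, add_zero]
  gcongr
  set x := arcTransform (k + 1) (2 * i) ξ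
  set y := arcTransform (k + 1) (2 * i + 1) ξ
  have := norm_sub_le x y
  nlinarith [sq_nonneg (‖x‖ - ‖y‖), norm_nonneg (x - y), norm_nonneg x, norm_nonneg y]

lemma add_rpow_le_two_rpow {a b q : ℝ} (ha : 0 ≤ a) (hb : 0 ≤ b) (hq : 0 ≤ q) :
    (a + b) ^ q ≤ 2 ^ q * (a ^ q + b ^ q) := by
  have h3 : a + b ≤ 2 * max a b := by linarith [le_max_left a b, le_max_right a b]
  have hm : 0 ≤ max a b := ha.trans (le_max_left _ _)
  calc (a + b) ^ q ≤ (2 * max a b) ^ q := by gcongr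
    _ = 2 ^ q * (max a b) ^ q := Real.mul_rpow (by norm_num) hm
    _ ≤ _ := by
        gcongr
        rcases max_cases a b with ⟨h, _⟩ | ⟨h, _⟩ <;> rw [h] <;>
          linarith [Real.rpow_nonneg ha q, Real.rpow_nonneg hb q]

/-- One step of the construction of the Cantor set. -/
theorem exists_next_generation {α p : ℝ} {d : ℕ} (hp : 2 ≤ p)
    (h1 : (d : ℝ) < α * p / 2) (h2 : ((d * (d - 1) / 2 : ℕ) : ℝ) + d < α * p - α)
    (h3 : ((d * (d - 1) / 2 : ℕ) : ℝ) + d < p - 1)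
    {e : ℕ → ℕ} (he : Monotone e) (hle : ∀ r, (e r : ℝ) ≤ α * r) (hge : ∀ r, α * r - 1 ≤ e r)
    (hstep : ∀ k, e (k + 1) = e k ∨ e (k + 1) = e k + 1) :
    ∃ C σ : ℝ, 0 < C ∧ 0 < σ ∧ σ < 1 ∧ ∀ k S, DyadicRegular e k S →
      ∃ S', DyadicRegular e (k + 1) S' ∧ (∀ i ∈ S', i / 2 ∈ S) ∧
        ∫⁻ ξ : EuclideanSpace ℝ (Fin d), ENNReal.ofReal
          (‖cantorTransform e (k + 1) S' ξ - cantorTransform e k S ξ‖ ^ p) ≤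
          ENNReal.ofReal (C * σ ^ k) := by
  obtain ⟨C, σ, hC, hσ0, hσ1, hsq⟩ := exists_lintegral_squareFunction_le hp h1 h2 h3 he hle hge
  have hp0 : 0 < p := by linarith
  obtain ⟨K, hK, hsign⟩ := exists_signs (volume : Measure (EuclideanSpace ℝ (Fin d))) hp0
  refine ⟨K * (2 ^ (p / 2) * (C * σ + C * σ)), σ, by positivity, hσ0, hσ1, fun k S hS => ?_⟩
  rcases hstep k with hek | hek
  swap
  · refine ⟨_, hS.split he hek, ?_, ?_⟩
    · intro i hi
      rcases Finset.mem_union.1 hi with hi | hi <;> obtain ⟨a, ha, rfl⟩ := Finset.mem_image.1 hi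
      · rwa [show 2 * a / 2 = a by omega]
      · rwa [show (2 * a + 1) / 2 = a by omega]
    · simp only [cantorTransform_split S hek, sub_self, norm_zero, Real.zero_rpow hp0.ne',
        ENNReal.ofReal_zero, lintegral_zero]
      exact zero_le
  obtain ⟨T, hT, hle'⟩ := hsign S (haarTransform e k) fun i => by
    unfold haarTransform
    have a1 := (continuous_arcTransform (d := d) (k + 1) (2 * i)).measurable
    have a2 := (continuous_arcTransform (d := d) (k + 1) (2 * i + 1)).measurable
    fun_prop
  have hs : ∀ i, (if i ∈ T then 0 else 1) ≤ 1 := fun i => by split_ifs <;> omega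
  refine ⟨_, hS.choose he hek hs, ?_, ?_⟩
  · intro i hi
    obtain ⟨a, ha, rfl⟩ := Finset.mem_image.1 hi
    have := hs a
    rwa [show (2 * a + if a ∈ T then 0 else 1) / 2 = a by omega]
  simp only [cantorTransform_choose S T hek]
  refine hle'.trans ?_
  have b0 := hsq (k + 1) _ (hS.choose he hek (s := fun _ => 0) fun _ => by omega)
  have b1 := hsq (k + 1) _ (hS.choose he hek (s := fun _ => 1) fun _ => le_rfl)
  set G0 : EuclideanSpace ℝ (Fin d) → ℝ := fun ξ => ((2 ^ e (k + 1))⁻¹) ^ 2 *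
    ∑ i ∈ S.image (fun i => 2 * i + 0), ‖arcTransform (k + 1) i ξ‖ ^ 2 with hG0
  set G1 : EuclideanSpace ℝ (Fin d) → ℝ := fun ξ => ((2 ^ e (k + 1))⁻¹) ^ 2 *
    ∑ i ∈ S.image (fun i => 2 * i + 1), ‖arcTransform (k + 1) i ξ‖ ^ 2 with hG1
  have hG0n : ∀ ξ, 0 ≤ G0 ξ := fun ξ => by positivity
  have hG1n : ∀ ξ, 0 ≤ G1 ξ := fun ξ => by positivity
  have hG0m : Measurable fun ξ => ENNReal.ofReal (G0 ξ ^ (p / 2)) := by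
    refine ENNReal.measurable_ofReal.comp (Measurable.pow_const ?_ _)
    refine (Finset.measurable_sum _ fun i _ => ?_).const_mul _
    exact (continuous_arcTransform (k + 1) i).measurable.norm.pow_const 2
  calc _ ≤ ENNReal.ofReal K * ∫⁻ ξ, ENNReal.ofReal (2 ^ (p / 2)) *
        (ENNReal.ofReal (G0 ξ ^ (p / 2)) + ENNReal.ofReal (G1 ξ ^ (p / 2))) := by
        gcongr with ξ
        rw [← ENNReal.ofReal_add (Real.rpow_nonneg (hG0n ξ) _) (Real.rpow_nonneg (hG1n ξ) _),
          ← ENNReal.ofReal_mul (by positivity)]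
        apply ENNReal.ofReal_le_ofReal
        refine le_trans ?_ (add_rpow_le_two_rpow (hG0n ξ) (hG1n ξ) (by positivity))
        exact Real.rpow_le_rpow (Finset.sum_nonneg fun i _ => sq_nonneg _)
          (sum_haarTransform_le S hek ξ) (by positivity)
    _ ≤ ENNReal.ofReal K * (ENNReal.ofReal (2 ^ (p / 2)) *
          (ENNReal.ofReal (C * σ ^ (k + 1)) + ENNReal.ofReal (C * σ ^ (k + 1)))) := by
        rw [lintegral_const_mul' _ _ ENNReal.ofReal_ne_top, lintegral_add_left hG0m]
        gcongr
    _ = _ := by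
        rw [← ENNReal.ofReal_add (by positivity) (by positivity),
          ← ENNReal.ofReal_mul (by positivity), ← ENNReal.ofReal_mul (by positivity)]
        congr 1
        rw [pow_succ]
        ring

/-- A nested sequence of regular generations whose transforms converge rapidly in `L^p`. -/
theorem exists_cantor_sequence {α p : ℝ} {d : ℕ} (hp : 2 ≤ p)
    (h1 : (d : ℝ) < α * p / 2) (h2 : ((d * (d - 1) / 2 : ℕ) : ℝ) + d < α * p - α)
    (h3 : ((d * (d - 1) / 2 : ℕ) : ℝ) + d < p - 1)
    {e : ℕ → ℕ} (he0 : e 0 = 0) (he : Monotone e) (hle : ∀ r, (e r : ℝ) ≤ α * r)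
    (hge : ∀ r, α * r - 1 ≤ e r) (hstep : ∀ k, e (k + 1) = e k ∨ e (k + 1) = e k + 1) :
    ∃ (S : ℕ → Finset ℕ) (C σ : ℝ), 0 < C ∧ 0 < σ ∧ σ < 1 ∧ (∀ k, DyadicRegular e k (S k)) ∧
      (∀ k, ∀ i ∈ S (k + 1), i / 2 ∈ S k) ∧
      (∫⁻ ξ : EuclideanSpace ℝ (Fin d), ENNReal.ofReal (‖cantorTransform e 0 (S 0) ξ‖ ^ p) < ⊤) ∧
      ∀ k, ∫⁻ ξ : EuclideanSpace ℝ (Fin d), ENNReal.ofReal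
        (‖cantorTransform e (k + 1) (S (k + 1)) ξ - cantorTransform e k (S k) ξ‖ ^ p) ≤
        ENNReal.ofReal (C * σ ^ k) := by
  obtain ⟨C, σ, hC, hσ0, hσ1, hnext⟩ :=
    exists_next_generation hp h1 h2 h3 he hle hge hstep
  obtain ⟨C', σ', -, -, -, hsq⟩ := exists_lintegral_squareFunction_le hp h1 h2 h3 he hle hge
  choose! next hreg hpar hbound using hnext
  let S : ℕ → Finset ℕ := fun k => Nat.rec {0} (fun k S => next k S) k
  have hS : ∀ k, DyadicRegular e k (S k) := by
    intro k
    induction k with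
    | zero => exact DyadicRegular.zero he0
    | succ k ih => exact hreg k _ ih
  refine ⟨S, C, σ, hC, hσ0, hσ1, hS, fun k => hpar k _ (hS k), ?_, fun k => hbound k _ (hS k)⟩
  refine lt_of_eq_of_lt ?_ ((hsq 0 _ (DyadicRegular.zero he0)).trans_lt ENNReal.ofReal_lt_top)
  refine lintegral_congr fun ξ => ?_
  change ENNReal.ofReal (‖cantorTransform e 0 {0} ξ‖ ^ p) = _
  congr 1
  rw [cantorTransform, Finset.sum_singleton, Finset.sum_singleton, he0]
  simp only [pow_zero, inv_one, one_mul, one_pow]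
  rw [← Real.rpow_natCast, ← Real.rpow_mul (norm_nonneg _)]
  congr 1
  push_cast
  ring

/-! ### Fourier inversion and the limit function -/

/-- The point `(t, t², …, t^d)` of the moment curve. -/
noncomputable def momentPoint (d : ℕ) (t : ℝ) : EuclideanSpace ℝ (Fin d) :=
  WithLp.toLp 2 fun i : Fin d => t ^ ((i : ℕ) + 1)

lemma continuous_momentPoint (d : ℕ) : Continuous (momentPoint d) := by
  unfold momentPoint
  fun_prop

lemma inner_momentPoint {d : ℕ} (ξ : EuclideanSpace ℝ (Fin d)) (t : ℝ) :
    inner ℝ ξ (momentPoint d t) = (momentPhase ξ).eval t := by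
  rw [momentPhase_eval, PiLp.inner_apply]
  refine Finset.sum_congr rfl fun i _ => ?_
  simp [momentPoint, mul_comm]

lemma dist_momentPoint_le (d : ℕ) {s t : ℝ} (hs : s ∈ Set.Icc (0 : ℝ) 1)
    (ht : t ∈ Set.Icc (0 : ℝ) 1) : dist (momentPoint d s) (momentPoint d t) ≤ d ^ 2 * |s - t| := by
  rw [EuclideanSpace.dist_eq]
  have hcoord : ∀ i : Fin d, dist ((momentPoint d s) i) ((momentPoint d t) i) ≤ d * |s - t| := by
    intro i
    change dist (s ^ ((i : ℕ) + 1)) (t ^ ((i : ℕ) + 1)) ≤ _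
    rw [Real.dist_eq]
    have hid : (((i : ℕ) + 1 : ℕ) : ℝ) ≤ d := by exact_mod_cast i.2
    have hmax : max |s| |t| ≤ 1 := by
      rw [abs_of_nonneg hs.1, abs_of_nonneg ht.1]; exact max_le hs.2 ht.2
    calc _ ≤ |s - t| * ((i : ℕ) + 1 : ℕ) * max |s| |t| ^ ((i : ℕ) + 1 - 1) := abs_pow_sub_pow_le ..
      _ ≤ |s - t| * d * 1 := by
          gcongr
          exact pow_le_one₀ (by positivity) hmax
      _ = _ := by ring
  apply Real.sqrt_le_iff.2 ⟨by positivity, ?_⟩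
  calc _ ≤ ∑ _i : Fin d, (d * |s - t|) ^ 2 := by
        refine Finset.sum_le_sum fun i _ => ?_
        exact pow_le_pow_left₀ dist_nonneg (hcoord i) 2
    _ = d * (d * |s - t|) ^ 2 := by simp
    _ ≤ (d ^ 2 * |s - t|) ^ 2 := by
        have h1 : (d : ℝ) ≤ d ^ 2 := by
          have : d ≤ d ^ 2 := Nat.le_self_pow two_ne_zero d
          exact_mod_cast this
        have : (d ^ 2 * |s - t|) ^ 2 = (d : ℝ) ^ 2 * (d * |s - t|) ^ 2 := by ring
        rw [this]
        gcongr

/-- Fourier inversion: the distributional Fourier transform of `arcTransform k i` is the uniform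
probability measure on the arc. -/
lemma integral_fourier_smul_arcTransform {d : ℕ} (k i : ℕ) (φ : 𝓢(EuclideanSpace ℝ (Fin d), ℂ)) :
    ∫ x, (𝓕 φ : 𝓢(EuclideanSpace ℝ (Fin d), ℂ)) x • arcTransform k i x =
      2 ^ k * ∫ t in ((i : ℝ) / 2 ^ k)..((i + 1) / 2 ^ k), φ (momentPoint d t) := by
  set a := (i : ℝ) / 2 ^ k
  set b := ((i : ℝ) + 1) / 2 ^ k
  set ψ : 𝓢(EuclideanSpace ℝ (Fin d), ℂ) := 𝓕 φ with hψ
  have hinv : ∀ t, ∫ x, Complex.exp (2 * Real.pi * Complex.I * ((momentPhase x).eval t : ℝ)) * ψ x =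
      φ (momentPoint d t) := by
    intro t
    have h1 : 𝓕⁻ (ψ : EuclideanSpace ℝ (Fin d) → ℂ) (momentPoint d t) = φ (momentPoint d t) := by
      rw [← SchwartzMap.fourierInv_coe, hψ, FourierTransform.fourierInv_fourier_eq]
    rw [← h1, Real.fourierInv_eq']
    refine integral_congr_ae (Filter.Eventually.of_forall fun x => ?_)
    simp only [inner_momentPoint, smul_eq_mul]
    congr 2
    push_cast
    ring
  have hcont : Continuous (Function.uncurry fun (t : ℝ) (x : EuclideanSpace ℝ (Fin d)) =>
      Complex.exp (2 * Real.pi * Complex.I * ((momentPhase x).eval t : ℝ)) * ψ x) := by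
    have := ψ.continuous
    simp only [Function.uncurry_def, momentPhase_eval]
    fun_prop
  have hint : Integrable (Function.uncurry fun (t : ℝ) (x : EuclideanSpace ℝ (Fin d)) =>
      Complex.exp (2 * Real.pi * Complex.I * ((momentPhase x).eval t : ℝ)) * ψ x)
      ((volume.restrict (Set.uIoc a b)).prod volume) := by
    have h1 : Integrable (fun z : ℝ × EuclideanSpace ℝ (Fin d) => (1 : ℂ) * ψ z.2)
        ((volume.restrict (Set.uIoc a b)).prod volume) := by
      have : IsFiniteMeasure (volume.restrict (Set.uIoc a b)) :=
        ⟨by rw [Measure.restrict_apply_univ, Set.uIoc]; exact measure_Ioc_lt_top⟩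
      exact Integrable.mul_prod (f := fun _ : ℝ => (1 : ℂ)) (g := ψ) (integrable_const 1) ψ.integrable
    refine h1.mono hcont.aestronglyMeasurable (Filter.Eventually.of_forall fun z => ?_)
    simp only [Function.uncurry_def, norm_mul, norm_oscInt_integrand, norm_one, le_refl]
  have hswap := intervalIntegral_integral_swap hint
  simp only [hinv] at hswap
  rw [hswap, ← integral_const_mul]
  refine integral_congr_ae (Filter.Eventually.of_forall fun x => ?_)
  simp only [arcTransform, oscInt, smul_eq_mul]
  rw [intervalIntegral.integral_mul_const]
  ring

lemma integrable_fourier_smul_arcTransform {d : ℕ} (k i : ℕ)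
    (ψ : 𝓢(EuclideanSpace ℝ (Fin d), ℂ)) :
    Integrable fun x => ψ x • arcTransform k i x := by
  refine ψ.integrable.mono
    (ψ.continuous.smul (continuous_arcTransform k i)).aestronglyMeasurable
    (Filter.Eventually.of_forall fun x => ?_)
  rw [norm_smul]
  exact mul_le_of_le_one_right (norm_nonneg _) (norm_arcTransform_le k i x)

lemma integral_fourier_smul_cantorTransform {d : ℕ} (e : ℕ → ℕ) (k : ℕ) (S : Finset ℕ)
    (φ : 𝓢(EuclideanSpace ℝ (Fin d), ℂ)) :
    ∫ x, (𝓕 φ : 𝓢(EuclideanSpace ℝ (Fin d), ℂ)) x • cantorTransform e k S x =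
      (2 ^ e k)⁻¹ * ∑ i ∈ S,
        2 ^ k * ∫ t in ((i : ℝ) / 2 ^ k)..((i + 1) / 2 ^ k), φ (momentPoint d t) := by
  have h1 : ∀ x, (𝓕 φ : 𝓢(EuclideanSpace ℝ (Fin d), ℂ)) x • cantorTransform e k S x =
      (2 ^ e k)⁻¹ * ∑ i ∈ S, (𝓕 φ : 𝓢(EuclideanSpace ℝ (Fin d), ℂ)) x • arcTransform k i x := by
    intro x
    simp only [cantorTransform, smul_eq_mul, ← Finset.mul_sum]
    ring
  simp only [h1]
  rw [integral_const_mul, integral_finsetSum _ fun i _ => integrable_fourier_smul_arcTransform k i _]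
  simp only [integral_fourier_smul_arcTransform]

/-- Bounded continuous functions that converge rapidly in `L^p` have a bounded limit in `L^p`, also
in the sense of distributions. -/
lemma exists_limit_function {d : ℕ} {p : ℝ} (hp : 1 ≤ p) (g : ℕ → EuclideanSpace ℝ (Fin d) → ℂ)
    (hg : ∀ k, Continuous (g k)) (hg1 : ∀ k x, ‖g k x‖ ≤ 1)
    (h0 : ∫⁻ x, ENNReal.ofReal (‖g 0 x‖ ^ p) < ⊤) {C σ : ℝ} (hC : 0 < C) (hσ0 : 0 < σ) (hσ1 : σ < 1)
    (hd : ∀ k, ∫⁻ x, ENNReal.ofReal (‖g (k + 1) x - g k x‖ ^ p) ≤ ENNReal.ofReal (C * σ ^ k)) :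
    ∃ f : EuclideanSpace ℝ (Fin d) → ℂ, MemLp f (ENNReal.ofReal p) ∧ MemLp f ⊤ ∧
      ∀ ψ : 𝓢(EuclideanSpace ℝ (Fin d), ℂ), Filter.Tendsto (fun k => ∫ x, ψ x • g k x)
        Filter.atTop (nhds (∫ x, ψ x • f x)) := by
  have hp0 : 0 < p := by linarith
  set P := ENNReal.ofReal p with hP
  have hP0 : P ≠ 0 := by rw [hP]; exact (ENNReal.ofReal_pos.2 hp0).ne'
  have hPt : P ≠ ⊤ := ENNReal.ofReal_ne_top
  have hPr : P.toReal = p := ENNReal.toReal_ofReal hp0.le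
  have : Fact (1 ≤ P) := ⟨by rw [hP, ← ENNReal.ofReal_one]; exact ENNReal.ofReal_le_ofReal hp⟩
  have hnorm : ∀ u : EuclideanSpace ℝ (Fin d) → ℂ,
      eLpNorm u P volume = (∫⁻ x, ENNReal.ofReal (‖u x‖ ^ p)) ^ (1 / p) := by
    intro u
    rw [eLpNorm_eq_lintegral_rpow_enorm_toReal hP0 hPt, hPr]
    congr 1
    refine lintegral_congr fun x => ?_
    rw [← ENNReal.ofReal_rpow_of_nonneg (norm_nonneg _) hp0.le, ofReal_norm]
  have hdiff : ∀ k, eLpNorm (g (k + 1) - g k) P volume ≤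
      ENNReal.ofReal (C ^ (1 / p) * (σ ^ (1 / p)) ^ k) := by
    intro k
    rw [hnorm]
    calc _ ≤ ENNReal.ofReal (C * σ ^ k) ^ (1 / p) := by gcongr; exact hd k
      _ = _ := by
        rw [ENNReal.ofReal_rpow_of_nonneg (by positivity) (by positivity),
          Real.mul_rpow hC.le (by positivity), ← Real.rpow_natCast σ k,
          ← Real.rpow_natCast (σ ^ (1 / p)) k, ← Real.rpow_mul hσ0.le, ← Real.rpow_mul hσ0.le,
          mul_comm (k : ℝ)]
  have hmem : ∀ k, MemLp (g k) P volume := by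
    intro k
    induction k with
    | zero =>
      refine ⟨(hg 0).aestronglyMeasurable, ?_⟩
      rw [hnorm]
      exact ENNReal.rpow_lt_top_of_nonneg (by positivity) h0.ne
    | succ k ih =>
      have : MemLp (g (k + 1) - g k) P volume :=
        ⟨((hg _).sub (hg _)).aestronglyMeasurable, (hdiff k).trans_lt ENNReal.ofReal_lt_top⟩
      have h2 := this.add ih
      rwa [sub_add_cancel] at h2
  let F : ℕ → Lp ℂ P (volume : Measure (EuclideanSpace ℝ (Fin d))) := fun k => (hmem k).toLp (g k)
  have hcauchy : CauchySeq F := by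
    refine cauchySeq_of_le_geometric (σ ^ (1 / p)) (C ^ (1 / p))
      (Real.rpow_lt_one hσ0.le hσ1 (by positivity)) fun k => ?_
    rw [dist_comm, dist_eq_norm, ← MemLp.toLp_sub, Lp.norm_toLp]
    exact ENNReal.toReal_le_of_le_ofReal (by positivity) (hdiff k)
  obtain ⟨f, hf⟩ := cauchySeq_tendsto_of_complete hcauchy
  refine ⟨f, Lp.memLp f, ?_, fun ψ => ?_⟩
  · obtain ⟨ns, -, hns⟩ := (tendstoInMeasure_of_tendsto_Lp hf).exists_seq_tendsto_ae
    refine memLp_top_of_bound (Lp.aestronglyMeasurable f) 1 ?_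
    have hae : ∀ᵐ x ∂(volume : Measure (EuclideanSpace ℝ (Fin d))), ∀ k, F k x = g k x :=
      ae_all_iff.2 fun k => (hmem k).coeFn_toLp
    filter_upwards [hns, hae] with x hx hx'
    refine le_of_tendsto hx.norm (Filter.Eventually.of_forall fun j => ?_)
    rw [hx']
    exact hg1 _ x
  · have hT := ((Lp.toTemperedDistributionCLM ℂ (volume : Measure (EuclideanSpace ℝ (Fin d)))
      P).continuous.tendsto f).comp hf
    have := PointwiseConvergenceCLM.tendsto_iff_forall_tendsto.1 hT ψ
    simp only [Function.comp_def, Lp.toTemperedDistributionCLM_apply,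
      Lp.toTemperedDistribution_apply] at this
    refine this.congr fun k => integral_congr_ae ?_
    filter_upwards [(hmem k).coeFn_toLp] with x hx
    rw [hx]

/-! ### Support, covering numbers and conclusion -/

/-- The part of the moment curve over the dyadic intervals indexed by `S`. -/
def dyadicArcs (d k : ℕ) (S : Finset ℕ) : Set (EuclideanSpace ℝ (Fin d)) :=
  momentPoint d '' ⋃ i ∈ S, Set.Icc ((i : ℝ) / 2 ^ k) ((i + 1) / 2 ^ k)

lemma isClosed_dyadicArcs (d k : ℕ) (S : Finset ℕ) : IsClosed (dyadicArcs d k S) :=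
  ((S.isCompact_biUnion fun _ _ => isCompact_Icc).image (continuous_momentPoint d)).isClosed

lemma dyadicArcs_succ_subset {d k : ℕ} {S S' : Finset ℕ} (h : ∀ i ∈ S', i / 2 ∈ S) :
    dyadicArcs d (k + 1) S' ⊆ dyadicArcs d k S := by
  refine Set.image_mono fun t ht => ?_
  simp only [Set.mem_iUnion] at ht ⊢
  obtain ⟨i, hi, h1, h2⟩ := ht
  refine ⟨i / 2, h i hi, ?_, ?_⟩
  · refine le_trans ?_ h1
    have : ((i / 2 : ℕ) : ℝ) * 2 ≤ i := by exact_mod_cast Nat.div_mul_le_self i 2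
    rw [div_le_div_iff₀ (by positivity) (by positivity), pow_succ]
    have h2k : (0 : ℝ) < 2 ^ k := by positivity
    nlinarith
  · refine h2.trans ?_
    have h3 : i + 1 ≤ (i / 2 + 1) * 2 := by omega
    have : (i : ℝ) + 1 ≤ (((i / 2 : ℕ) : ℝ) + 1) * 2 := by exact_mod_cast h3
    rw [div_le_div_iff₀ (by positivity) (by positivity), pow_succ]
    have h2k : (0 : ℝ) < 2 ^ k := by positivity
    nlinarith

lemma DyadicRegular.Icc_subset {e : ℕ → ℕ} {k : ℕ} {S : Finset ℕ} (h : DyadicRegular e k S) {i : ℕ}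
    (hi : i ∈ S) : Set.Icc ((i : ℝ) / 2 ^ k) ((i + 1) / 2 ^ k) ⊆ Set.Icc 0 1 := by
  refine Set.Icc_subset_Icc (by positivity) ?_
  rw [div_le_one (by positivity)]
  exact_mod_cast h.lt i hi

lemma DyadicRegular.dyadicArcs_subset {e : ℕ → ℕ} {d k : ℕ} {S : Finset ℕ}
    (h : DyadicRegular e k S) : dyadicArcs d k S ⊆ momentCurve d :=
  Set.image_mono (Set.iUnion₂_subset fun _ hi => h.Icc_subset hi)

/-- A test function that equals `1` on the moment curve. -/
lemma exists_schwartz_eq_one (d : ℕ) :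
    ∃ φ : 𝓢(EuclideanSpace ℝ (Fin d), ℂ), ∀ x ∈ momentCurve d, φ x = 1 := by
  have hcomp : IsCompact (momentCurve d) := isCompact_Icc.image (continuous_momentPoint d)
  obtain ⟨R, hR⟩ := hcomp.isBounded.subset_closedBall (0 : EuclideanSpace ℝ (Fin d))
  let b : ContDiffBump (0 : EuclideanSpace ℝ (Fin d)) :=
    ⟨max R 1, max R 1 + 1, lt_max_of_lt_right one_pos, by linarith⟩
  have h1 : HasCompactSupport (Complex.ofRealCLM ∘ b) := b.hasCompactSupport.comp_left rfl
  have h2 : ContDiff ℝ ((⊤ : ℕ∞) : WithTop ℕ∞) (Complex.ofRealCLM ∘ b) := Complex.ofRealCLM.contDiff.comp b.contDiff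
  refine ⟨h1.toSchwartzMap h2, fun x hx => ?_⟩
  have : b x = 1 := b.one_of_mem_closedBall
    (Metric.closedBall_subset_closedBall (le_max_left R 1) (hR hx))
  change Complex.ofRealCLM (b x) = 1
  rw [this]
  simp

lemma externalCoveringNumber_dyadicArcs_le {e : ℕ → ℕ} {d k : ℕ} {S : Finset ℕ}
    (h : DyadicRegular e k S) {ε : ℝ≥0} (hε : (d : ℝ) ^ 2 / 2 ^ k ≤ ε) :
    (Metric.externalCoveringNumber ε (dyadicArcs d k S) : ℝ≥0∞) ≤ (2 : ℝ≥0∞) ^ e k := by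
  classical
  set N : Finset (EuclideanSpace ℝ (Fin d)) :=
    S.image fun i : ℕ => momentPoint d ((i : ℝ) / 2 ^ k) with hN
  have hcover : Metric.IsCover ε (dyadicArcs d k S) (N : Set (EuclideanSpace ℝ (Fin d))) := by
    rw [Metric.isCover_iff_subset_iUnion_closedBall]
    rintro _ ⟨t, ht, rfl⟩
    simp only [Set.mem_iUnion] at ht ⊢
    obtain ⟨i, hi, hti⟩ := ht
    refine ⟨_, Finset.mem_coe.2 (Finset.mem_image_of_mem _ hi), ?_⟩
    rw [Metric.mem_closedBall]
    refine (dist_momentPoint_le d (h.Icc_subset hi hti)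
      (h.Icc_subset hi ⟨le_rfl, dyadic_le k i⟩)).trans (le_trans ?_ hε)
    have h1 : |t - i / 2 ^ k| ≤ 1 / 2 ^ k := by
      rw [abs_of_nonneg (by linarith [hti.1]), ← dyadic_sub k i]
      linarith [hti.2]
    calc _ ≤ (d : ℝ) ^ 2 * (1 / 2 ^ k) := by gcongr
      _ = _ := by ring
  have h1 := hcover.externalCoveringNumber_le_encard
  rw [Set.encard_coe_eq_coe_finsetCard] at h1
  have h2 : N.card ≤ 2 ^ e k := Finset.card_image_le.trans h.card_eq.le
  calc (Metric.externalCoveringNumber ε (dyadicArcs d k S) : ℝ≥0∞)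
      ≤ (((N.card : ℕ∞)) : ℝ≥0∞) := by exact_mod_cast h1
    _ ≤ (2 : ℝ≥0∞) ^ e k := by
        have : ((N.card : ℕ) : ℝ≥0∞) ≤ ((2 ^ e k : ℕ) : ℝ≥0∞) := by exact_mod_cast h2
        simpa using this

/-- Above the critical exponent the three scale conditions hold. -/
lemma exponent_conditions {d : ℕ} (hd : 2 ≤ d) {α p : ℝ} (hα0 : 0 < α) (hα1 : α ≤ 1)
    (hp : criticalExponent d α < p) :
    (d : ℝ) < α * p / 2 ∧ ((d * (d - 1) / 2 : ℕ) : ℝ) + d < α * p - α ∧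
      ((d * (d - 1) / 2 : ℕ) : ℝ) + d < p - 1 := by
  have hcast : ((d * (d - 1) / 2 : ℕ) : ℝ) = d * (d - 1) / 2 := by
    rw [Nat.cast_div (Nat.even_mul_pred_self d).two_dvd (by norm_num), Nat.cast_mul,
      Nat.cast_sub (by omega)]
    push_cast; rfl
  rw [hcast]
  have hd' : (2 : ℝ) ≤ d := by exact_mod_cast hd
  -- since `α ≤ 1`, the third condition follows from the second
  suffices h : (d : ℝ) < α * p / 2 ∧ (d : ℝ) * (d - 1) / 2 + d < α * p - α by
    refine ⟨h.1, h.2, ?_⟩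
    have hp1 : 0 < p - 1 := by
      by_contra! hcon
      have := mul_nonpos_of_nonneg_of_nonpos hα0.le hcon
      nlinarith [h.2]
    nlinarith [h.2]
  rw [criticalExponent] at hp
  split_ifs at hp with h2
  · subst h2
    rw [div_lt_iff₀ hα0] at hp
    push_cast
    constructor <;> linarith
  · have hd3 : (3 : ℝ) ≤ d := by exact_mod_cast (show 3 ≤ d by omega)
    rw [div_lt_iff₀ (by positivity)] at hp
    constructor <;> nlinarith

lemma criticalExponent_nonneg {d : ℕ} {α : ℝ} (hα0 : 0 < α) : 0 ≤ criticalExponent d α := by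
  rw [criticalExponent]
  split_ifs <;> positivity

/-- The instance hypothesis `1 ≤ p` is implied by `p_α < p`; it is only needed in order to speak of
the Fourier transform of an element of `L^p`. Here `Metric.externalCoveringNumber ε S` is the least
number of balls of radius `ε` with centres in `ℝ^d` that cover `S`. -/
theorem theorem1p2 (d : ℕ) (hd : 2 ≤ d) (α : ℝ) (hα0 : 0 < α) (hα1 : α ≤ 1)
    (p : ℝ≥0∞) [Fact (1 ≤ p)] (hp : ENNReal.ofReal (criticalExponent d α) < p) :
    ∃ f : Lp ℂ p (volume : Measure (EuclideanSpace ℝ (Fin d))),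
      f ≠ 0 ∧
      fourierSupport f ⊆ momentCurve d ∧
      ∃ C : ℝ, ∀ ε : ℝ≥0, 0 < ε → ε < 1 →
        (Metric.externalCoveringNumber ε (fourierSupport f) : ℝ≥0∞) ≤
          ENNReal.ofReal (C * (ε : ℝ) ^ (-α)) := by
  -- for `p = ∞` the function of any finite admissible exponent will do, as it is bounded
  obtain ⟨p₀, hp₀, hpp⟩ : ∃ p₀ : ℝ, criticalExponent d α < p₀ ∧ (p = ⊤ ∨ p = ENNReal.ofReal p₀) := by
    by_cases htop : p = ⊤
    · exact ⟨criticalExponent d α + 1, by linarith, Or.inl htop⟩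
    · exact ⟨p.toReal, (ENNReal.ofReal_lt_iff_lt_toReal (criticalExponent_nonneg hα0) htop).1 hp,
        Or.inr (ENNReal.ofReal_toReal htop).symm⟩
  obtain ⟨h1, h2, h3⟩ := exponent_conditions hd hα0 hα1 hp₀
  have hd' : (2 : ℝ) ≤ d := by exact_mod_cast hd
  have hp2 : 2 ≤ p₀ := by
    have : (0 : ℝ) ≤ ((d * (d - 1) / 2 : ℕ) : ℝ) := by positivity
    linarith
  set e : ℕ → ℕ := fun k => ⌊α * k⌋₊ with he
  have hle : ∀ r, (e r : ℝ) ≤ α * r := fun r => Nat.floor_le (by positivity)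
  have hge : ∀ r, α * r - 1 ≤ e r := fun r => (Nat.sub_one_lt_floor _).le
  have hmono : Monotone e := fun a b hab => Nat.floor_le_floor (by gcongr)
  have hstep : ∀ k, e (k + 1) = e k ∨ e (k + 1) = e k + 1 := by
    intro k
    have a1 : e k ≤ e (k + 1) := hmono (Nat.le_succ k)
    have a2 : e (k + 1) ≤ e k + 1 := by
      have : e (k + 1) ≤ ⌊α * k + 1⌋₊ := Nat.floor_le_floor (by push_cast; linarith)
      rwa [Nat.floor_add_one (by positivity)] at this
    omega
  obtain ⟨S, C, σ, hC, hσ0, hσ1, hreg, hpar, hzero, hdiff⟩ :=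
    exists_cantor_sequence hp2 h1 h2 h3 (e := e) (by simp [he]) hmono hle hge hstep
  obtain ⟨g, hgp, hgt, hlim⟩ := exists_limit_function (by linarith)
    (fun k => cantorTransform e k (S k)) (fun k => continuous_cantorTransform e k (S k))
    (fun k => norm_cantorTransform_le (hreg k)) hzero hC hσ0 hσ1 hdiff
  have hg : MemLp g p volume := by
    rcases hpp with rfl | rfl
    · exact hgt
    · exact hgp
  have hpair : ∀ φ : 𝓢(EuclideanSpace ℝ (Fin d), ℂ), Filter.Tendsto (fun k => (2 ^ e k : ℂ)⁻¹ *
      ∑ i ∈ S k, 2 ^ k * ∫ t in ((i : ℝ) / 2 ^ k)..((i + 1) / 2 ^ k), φ (momentPoint d t))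
      Filter.atTop (nhds ((𝓕 (Lp.toTemperedDistribution (hg.toLp g) :
        𝓢'(EuclideanSpace ℝ (Fin d), ℂ)) : 𝓢'(EuclideanSpace ℝ (Fin d), ℂ)) φ)) := by
    intro φ
    rw [TemperedDistribution.fourier_apply, Lp.toTemperedDistribution_apply]
    have hae : ∫ x, (𝓕 φ : 𝓢(EuclideanSpace ℝ (Fin d), ℂ)) x • hg.toLp g x =
        ∫ x, (𝓕 φ : 𝓢(EuclideanSpace ℝ (Fin d), ℂ)) x • g x := by
      refine integral_congr_ae ?_
      filter_upwards [hg.coeFn_toLp] with x hx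
      rw [hx]
    rw [hae]
    simpa only [integral_fourier_smul_cantorTransform] using hlim (𝓕 φ)
  have hanti : Antitone fun k => dyadicArcs d k (S k) :=
    antitone_nat_of_succ_le fun k => dyadicArcs_succ_subset (hpar k)
  have hsupp : ∀ k, fourierSupport (hg.toLp g) ⊆ dyadicArcs d k (S k) := by
    intro k x hx
    rw [fourierSupport, Distribution.mem_dsupport_iff] at hx
    refine hx _ (fun u hu => ?_) (isClosed_dyadicArcs d k (S k))
    refine tendsto_nhds_unique (hpair u) (tendsto_const_nhds.congr' ?_)
    filter_upwards [Filter.eventually_ge_atTop k] with n hn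
    rw [Finset.sum_eq_zero, mul_zero]
    intro i hi
    rw [intervalIntegral.integral_congr (g := fun _ => (0 : ℂ)), intervalIntegral.integral_zero,
      mul_zero]
    intro t ht
    rw [Set.uIcc_of_le (dyadic_le n i)] at ht
    have hmem : momentPoint d t ∈ dyadicArcs d k (S k) :=
      hanti hn ⟨t, Set.mem_iUnion₂.2 ⟨i, hi, ht⟩, rfl⟩
    exact image_eq_zero_of_notMem_tsupport fun h' => hu h' hmem
  refine ⟨hg.toLp g, ?_, (hsupp 0).trans (hreg 0).dyadicArcs_subset, (2 * d ^ 2) ^ α,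
    fun ε hε0 hε1 => ?_⟩
  · -- tested against a function that is `1` on the curve, every generation has total mass `1`
    intro hzero'
    obtain ⟨φ, hφ⟩ := exists_schwartz_eq_one d
    have hone : ∀ k, (2 ^ e k : ℂ)⁻¹ * ∑ i ∈ S k,
        2 ^ k * ∫ t in ((i : ℝ) / 2 ^ k)..((i + 1) / 2 ^ k), φ (momentPoint d t) = 1 := by
      intro k
      have : ∀ i ∈ S k, (2 : ℂ) ^ k *
          ∫ t in ((i : ℝ) / 2 ^ k)..((i + 1) / 2 ^ k), φ (momentPoint d t) = 1 := by
        intro i hi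
        rw [intervalIntegral.integral_congr (g := fun _ => (1 : ℂ)),
          intervalIntegral.integral_const, dyadic_sub]
        · simp
        · intro t ht
          rw [Set.uIcc_of_le (dyadic_le k i)] at ht
          exact hφ _ ⟨t, (hreg k).Icc_subset hi ht, rfl⟩
      rw [Finset.sum_congr rfl this, Finset.sum_const, (hreg k).card_eq]
      simp
    have hlim1 := hpair φ
    simp only [hone, hzero'] at hlim1
    have h01 := tendsto_nhds_unique hlim1 tendsto_const_nhds
    have hTz : (Lp.toTemperedDistribution (0 : Lp ℂ p (volume : Measure
        (EuclideanSpace ℝ (Fin d)))) : 𝓢'(EuclideanSpace ℝ (Fin d), ℂ)) = 0 :=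
      map_zero (Lp.toTemperedDistributionCLM ℂ (volume : Measure (EuclideanSpace ℝ (Fin d))) p)
    rw [TemperedDistribution.fourier_apply, hTz] at h01
    exact zero_ne_one h01
  · have hε0' : (0 : ℝ) < ε := hε0
    have hε1' : (ε : ℝ) < 1 := hε1
    have hex : ∃ k : ℕ, (d : ℝ) ^ 2 / 2 ^ k ≤ ε := by
      obtain ⟨k, hk⟩ := pow_unbounded_of_one_lt ((d : ℝ) ^ 2 / ε) (one_lt_two : (1 : ℝ) < 2)
      refine ⟨k, ?_⟩
      rw [div_lt_iff₀ hε0'] at hk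
      rw [div_le_iff₀ (by positivity)]
      linarith
    classical
    obtain ⟨k, hk, hmin⟩ : ∃ k, (d : ℝ) ^ 2 / 2 ^ k ≤ ε ∧ (2 : ℝ) ^ k ≤ 2 * d ^ 2 / ε := by
      refine ⟨Nat.find hex, Nat.find_spec hex, ?_⟩
      have h0 : Nat.find hex ≠ 0 := by
        intro h
        have := Nat.find_spec hex
        rw [h] at this
        norm_num at this
        nlinarith
      obtain ⟨s, hs⟩ := Nat.exists_eq_succ_of_ne_zero h0
      have hlt := Nat.find_min hex (m := s) (by omega)
      push Not at hlt
      rw [lt_div_iff₀ (by positivity)] at hlt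
      rw [hs, Nat.succ_eq_add_one, pow_succ, le_div_iff₀ hε0']
      linarith
    calc (Metric.externalCoveringNumber ε (fourierSupport (hg.toLp g)) : ℝ≥0∞)
        ≤ (Metric.externalCoveringNumber ε (dyadicArcs d k (S k)) : ℝ≥0∞) := by
          exact_mod_cast Metric.externalCoveringNumber_mono_set (hsupp k)
      _ ≤ (2 : ℝ≥0∞) ^ e k := externalCoveringNumber_dyadicArcs_le (hreg k) hk
      _ = ENNReal.ofReal (2 ^ e k) := by
          rw [ENNReal.ofReal_pow (by norm_num)]; norm_num
      _ ≤ _ := by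
          apply ENNReal.ofReal_le_ofReal
          calc (2 : ℝ) ^ e k = 2 ^ (e k : ℝ) := (Real.rpow_natCast _ _).symm
            _ ≤ 2 ^ (α * k) := Real.rpow_le_rpow_of_exponent_le one_le_two (hle k)
            _ = ((2 : ℝ) ^ k) ^ α := by
                rw [mul_comm, Real.rpow_mul two_pos.le, Real.rpow_natCast]
            _ ≤ (2 * d ^ 2 / ε) ^ α := by gcongr
            _ = (2 * d ^ 2) ^ α * (ε : ℝ) ^ (-α) := by
                rw [Real.div_rpow (by positivity) hε0'.le, Real.rpow_neg hε0'.le, div_eq_mul_inv]
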